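/- **Proposition.** Let $\mathcal M$ be a combinatorial model category (i.e. locally presentable as a category, and cofibrantly generated as a model category) in which every object is fibrant, and let $K$ be a set of objects of $\mathcal M$. For objects $X, Y$ let $\mathrm{map}(X,Y)=\mathcal M(\tilde X,\hat Y_\bullet)$ denote the right homotopy function complex, where $\tilde X\to X$ is a cofibrant approximation (a weak equivalence with $\tilde X$ cofibrant) and $\hat Y_\bullet$ is a simplicial resolution of $Y$ (a Reedy fibrant simplicial object with a levelwise weak equivalence from the constant simplicial object at $Y$). A map $f$ is a *$K$-colocal equivalence* if $\mathrm{map}(X,f)$, computed with a cofibrant approximation to $X$ and a map of simplicial resolutions extending $f$, is a weak equivalence of simplicial sets for all $X\in K$ (this does not depend on the choices). Then the right Bousfield localization $R_K\mathcal M$ exists: there is a model structure on the underlying category of $\mathcal M$ whose weak equivalences are the $K$-colocal equivalences and whose fibrations are the fibrations of $\mathcal M$. It is combinatorial, and every object is fibrant in it. Moreover, every $A\in K$ has a cosimplicial resolution (a Reedy cofibrant cosimplicial object with a levelwise weak equivalence to the constant cosimplicial object at $A$), and for every choice of a cosimplicial resolution $A^\bullet$ of each $A\in K$ and every set $J$ of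 generating trivial cofibrations of $\mathcal M$, the model category $R_K\mathcal M$ is cofibrantly generated with generating cofibrations $\Lambda(K)\cup J$, where $$\Lambda(K)=\bigl\{A^\bullet\otimes\partial\Delta[n]\to A^\bullet\otimes\Delta[n] : A\in K,\ n\ge 0\bigr\},$$ and with generating trivial cofibrations $J$. Here $A^\bullet\otimes L$, for a simplicial set $L$, is the colimit of $A^m$ over the category of simplices $\Delta[m]\to L$ of $L$. -/

import Mathlib

universe w u

open CategoryTheory Limits HomotopicalAlgebra Opposite Simplicial

namespace RightBousfield

noncomputable section

/-! ### Weak equivalences of simplicial sets -/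

/-- Homotopy classes of maps of simplicial sets: the quotient of `X ⟶ Z` by the equivalence
relation generated by simplicial homotopy. -/
def HomotopyClasses (X Z : SSet.{w}) : Type w :=
  Quot (fun a b : X ⟶ Z ↦ Nonempty (SSet.Homotopy a b))

/-- Precomposition with `f` on homotopy classes. -/
def HomotopyClasses.precomp {X Y : SSet.{w}} (f : X ⟶ Y) (Z : SSet.{w}) :
    HomotopyClasses Y Z → HomotopyClasses X Z :=
  Quot.map (fun a ↦ f ≫ a) (fun _ _ ⟨H⟩ ↦
    ⟨SSet.RelativeMorphism.Homotopy.precomp H (SSet.RelativeMorphism.botEquiv.symm f)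
      (SSet.Subcomplex.isInitialBot.hom_ext _ _)⟩)

/-- A weak homotopy equivalence of simplicial sets: for every Kan complex `Z`, precomposition
with `f` is a bijection `[Y, Z] → [X, Z]` on homotopy classes of maps. -/
def IsWeakHomotopyEquivalence {X Y : SSet.{w}} (f : X ⟶ Y) : Prop :=
  ∀ (Z : SSet.{w}), SSet.KanComplex Z → Function.Bijective (HomotopyClasses.precomp f Z)

variable {C : Type u} [Category.{w} C]

/-! ### Tensoring a cosimplicial object, and cotensoring a simplicial object, with a
simplicial set

`CostructuredArrow simplexFunctor K` is the category of simplices of `K`: its objects are the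
maps `Δ[n] ⟶ K`. -/

/-- The functor `[n] ↦ Δ[n]`. -/
abbrev simplexFunctor : SimplexCategory ⥤ SSet.{w} := SSet.stdSimplex

instance [HasColimits C] (K : SSet.{w}) :
    HasColimitsOfShape (CostructuredArrow simplexFunctor.{w} K) C :=
  (hasColimitsOfSizeShrink.{0, w, w, w} C).has_colimits_of_shape _

instance [HasLimits C] (K : SSet.{w}) :
    HasLimitsOfShape (CostructuredArrow simplexFunctor.{w} K)ᵒᵖ C :=
  (hasLimitsOfSizeShrink.{0, w, w, w} C).has_limits_of_shape _

/-- The map `[m] ⟶ [n]` which corresponds to a simplex `Δ[m] ⟶ ∂Δ[n]`. -/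
def boundaryHom {n : ℕ} (σ : CostructuredArrow simplexFunctor.{w} (∂Δ[n] : SSet.{w})) :
    σ.left ⟶ ⦋n⦌ :=
  SSet.stdSimplex.fullyFaithful.preimage (σ.hom ≫ (SSet.boundary n).ι)

lemma comp_boundaryHom {n : ℕ}
    {σ τ : CostructuredArrow simplexFunctor.{w} (∂Δ[n] : SSet.{w})} (g : σ ⟶ τ) :
    g.left ≫ boundaryHom τ = boundaryHom σ := by
  apply SSet.stdSimplex.{w}.map_injective
  refine (Functor.map_comp _ _ _).trans ?_
  refine (congrArg (SSet.stdSimplex.{w}.map g.left ≫ ·)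
    (SSet.stdSimplex.fullyFaithful.map_preimage _)).trans ?_
  refine Eq.trans ?_ (SSet.stdSimplex.fullyFaithful.map_preimage _).symm
  exact (Category.assoc _ _ _).symm.trans
    (congrArg (· ≫ (SSet.boundary n).ι) (CostructuredArrow.w g))

section

variable [HasColimits C] (A : SimplexCategory ⥤ C)

/-- `A ⊗ K`, the colimit of `A⁽ᵐ⁾` over all simplices `Δ[m] ⟶ K`. -/
def tensorObj (K : SSet.{w}) : C :=
  colimit (CostructuredArrow.proj simplexFunctor.{w} K ⋙ A)

/-- The functoriality `A ⊗ K ⟶ A ⊗ L` for `f : K ⟶ L`. -/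
def tensorMap {K L : SSet.{w}} (f : K ⟶ L) : tensorObj A K ⟶ tensorObj A L :=
  colimit.pre (CostructuredArrow.proj simplexFunctor.{w} L ⋙ A) (CostructuredArrow.map f)

/-- The latching map `A ⊗ ∂Δ[n] ⟶ A⁽ⁿ⁾`. -/
def latchingMap (n : ℕ) : tensorObj A (∂Δ[n] : SSet.{w}) ⟶ A.obj ⦋n⦌ :=
  colimit.desc (CostructuredArrow.proj simplexFunctor.{w} (∂Δ[n] : SSet.{w}) ⋙ A)
    { pt := A.obj ⦋n⦌
      ι :=
        { app := fun σ ↦ A.map (boundaryHom σ)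
          naturality := fun _ _ g ↦
            ((A.map_comp _ _).symm.trans (congrArg A.map (comp_boundaryHom g))).trans
              (Category.comp_id _).symm } }

end

section

variable [HasLimits C] (Y : SimplexCategoryᵒᵖ ⥤ C)

/-- `Y ^ K`, the limit of `Y_m` over all simplices `Δ[m] ⟶ K`. -/
def cotensorObj (K : SSet.{w}) : C :=
  limit ((CostructuredArrow.proj simplexFunctor.{w} K).op ⋙ Y)

/-- The matching map `Y_n ⟶ Y ^ ∂Δ[n]`. -/
def matchingMap (n : ℕ) : Y.obj (op ⦋n⦌) ⟶ cotensorObj Y (∂Δ[n] : SSet.{w}) :=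
  limit.lift ((CostructuredArrow.proj simplexFunctor.{w} (∂Δ[n] : SSet.{w})).op ⋙ Y)
    { pt := Y.obj (op ⦋n⦌)
      π :=
        { app := fun σ ↦ Y.map (boundaryHom σ.unop).op
          naturality := fun σ _ g ↦
            (Category.id_comp _).trans
              ((congrArg (fun h ↦ Y.map h.op) (comp_boundaryHom g.unop)).symm.trans
                (Y.map_comp (boundaryHom σ.unop).op g.unop.left.op)) } }

end

/-! ### Resolutions and homotopy function complexes -/

/-- A cosimplicial resolution of `A`: a Reedy cofibrant cosimplicial object with a levelwise
weak equivalence to the constant cosimplicial object at `A`. -/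
structure CosimplicialResolution [HasColimits C] (M : ModelCategory C) (A : C) where
  obj : SimplexCategory ⥤ C
  π : obj ⟶ (Functor.const SimplexCategory).obj A
  weakEquivalence : ∀ m : SimplexCategory, WeakEquivalence (π.app m)
  reedyCofibrant : ∀ n : ℕ, Cofibration (latchingMap obj n)

/-- A simplicial resolution of `Y`: a Reedy fibrant simplicial object with a levelwise
weak equivalence from the constant simplicial object at `Y`. -/
structure SimplicialResolution [HasLimits C] (M : ModelCategory C) (Y : C) where
  obj : SimplexCategoryᵒᵖ ⥤ C
  ι : (Functor.const SimplexCategoryᵒᵖ).obj Y ⟶ obj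
  weakEquivalence : ∀ m : SimplexCategoryᵒᵖ, WeakEquivalence (ι.app m)
  reedyFibrant : ∀ n : ℕ, Fibration (matchingMap obj n)

/-- A simplicial resolution of a map `f`: a map between simplicial resolutions of its source
and target which extends `f`. -/
structure SimplicialResolutionHom [HasLimits C] (M : ModelCategory C) {A B : C} (f : A ⟶ B) where
  source : SimplicialResolution M A
  target : SimplicialResolution M B
  hom : source.obj ⟶ target.obj
  comm : source.ι ≫ hom = (Functor.const SimplexCategoryᵒᵖ).map f ≫ target.ι

/-- A cofibrant approximation to `X`. -/
structure CofibrantApproximation (M : ModelCategory C) (X : C) where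
  obj : C
  π : obj ⟶ X
  cofibrant : IsCofibrant obj
  weakEquivalence : WeakEquivalence π

/-- The simplicial set `C(X, Y_•)`. It is the right homotopy function complex `map(X', Y')` when
`X` is a cofibrant approximation to `X'` and `Y` is a simplicial resolution of `Y'`. -/
def homComplex (X : C) (Y : SimplexCategoryᵒᵖ ⥤ C) : SSet.{w} :=
  Y ⋙ coyoneda.obj (op X)

/-- The map `C(X, Y_•) ⟶ C(X, Y'_•)` induced by `g : Y ⟶ Y'`. -/
def homComplexMap (X : C) {Y Y' : SimplexCategoryᵒᵖ ⥤ C} (g : Y ⟶ Y') :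
    homComplex X Y ⟶ homComplex X Y' :=
  Functor.whiskerRight g (coyoneda.obj (op X))

/-! ### Right Bousfield localization -/

/-- The `K`-colocal equivalences: the maps `f` such that `map(X, f)` is a weak equivalence of
simplicial sets for all `X` in `K`, where `map` is the right homotopy function complex, computed
by a cofibrant approximation to `X` and a simplicial resolution of `f`. (Whether `map(X, f)` is a
weak equivalence does not depend on these choices.) -/
def colocalEquivalences [HasLimits C] (M : ModelCategory C) (K : ObjectProperty C) :
    MorphismProperty C :=
  fun _ _ f ↦ ∀ X : C, K X → ∃ (X' : CofibrantApproximation M X)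
    (r : SimplicialResolutionHom M f), IsWeakHomotopyEquivalence (homComplexMap X'.obj r.hom)

/-- The model structure `R` is the right Bousfield localization of the model structure `M`
with respect to `K`: its weak equivalences are the `K`-colocal equivalences of `M` and its
fibrations are the fibrations of `M`. -/
structure IsRightBousfieldLocalization [HasLimits C] (M : ModelCategory C) (K : ObjectProperty C)
    (R : ModelCategory C) : Prop where
  weakEquivalences_eq :
    R.categoryWithWeakEquivalences.weakEquivalences = colocalEquivalences M K
  fibrations_eq :
    R.categoryWithFibrations.fibrations = M.categoryWithFibrations.fibrations

/-- The model structure `M` is cofibrantly generated, with `I` a set of generating cofibrations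
and `J` a set of generating trivial cofibrations. (The smallness of the sets `I` and `J` is part
of `HasSmallObjectArgument`.) -/
structure IsCofibrantlyGeneratedBy (M : ModelCategory C) (I J : MorphismProperty C) : Prop where
  smallObjectArgument_I : MorphismProperty.HasSmallObjectArgument.{w} I
  smallObjectArgument_J : MorphismProperty.HasSmallObjectArgument.{w} J
  rlp_I : I.rlp = trivialFibrations C
  rlp_J : J.rlp = fibrations C

/-- A model category is combinatorial if it is locally presentable as a category and cofibrantly
generated as a model category. -/
structure IsCombinatorial (M : ModelCategory C) : Prop where
  isLocallyPresentable : IsLocallyPresentable.{w} C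
  exists_generators : ∃ I J : MorphismProperty C, IsCofibrantlyGeneratedBy M I J

/-- Every object is fibrant for the model structure `M`. -/
def AllObjectsFibrant (M : ModelCategory C) : Prop :=
  ∀ X : C, IsFibrant X

/-- `Λ(K)`, the maps `A^• ⊗ ∂Δ[n] ⟶ A^• ⊗ Δ[n]` for `A` in `K` and `n ≥ 0`, where `A^•` is the
cosimplicial resolution of `A` chosen by `res`. -/
def Lambda [HasColimits C] {M : ModelCategory C} (K : ObjectProperty C)
    (res : ∀ A : C, K A → CosimplicialResolution M A) : MorphismProperty C :=
  MorphismProperty.ofHoms (fun i : Subtype K × ℕ ↦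
    tensorMap (res i.1.1 i.1.2).obj (SSet.boundary.{w} i.2).ι)

end

end RightBousfield

/-!
Fix a cosimplicial resolution `A^•` of each `A` in `K`. The proof compares the function complex
`map(A, f)` with the map of singular complexes `C(A^•, f)`. When `f` comes from a Reedy fibration
`Y_• ⟶ Z_•` of homotopically constant Reedy fibrant objects, both are Kan fibrations between Kan
complexes, so each is a weak equivalence if and only if it lifts against the boundary inclusions.
For `map(A, f)` these lifting problems pit the object `A` against the relative matching maps of
`Y_• ⟶ Z_•`; for `C(A^•, f)` they pit the maps `A^• ⊗ ∂Δ[n] ⟶ A^• ⊗ Δ[n]` against the map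
`Y_0 ⟶ Z_0`. The two families are exchanged one dimension at a time: up to a
horn inclusion, which is harmless, `∂Δ[n + 1]` arises by attaching `Δ[n]` along `∂Δ[n]`, on the side
of `A^•` as well as on the side of `Y_•`. This takes the place of the diagonal of the bisimplicial
set `C(A^•, Y_•)`. A general map is reduced to a Reedy fibration by factoring it through a mapping
path object.

As every object is fibrant, the colocal equivalences are therefore the maps that all the functors
`C(A^•, -)` send to weak equivalences. Hence they have the two-out-of-three property, they contain
the weak equivalences, and a fibration is a colocal equivalence if and only if it has the right
lifting property with respect to `Λ(K)`. The recognition theorem for cofibrantly generated model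
categories then applies to `Λ(K) ∪ J` and `J`, whose small object arguments exist because the
category is locally presentable.
-/

namespace RightBousfield

noncomputable section

/-! ### Weak homotopy equivalences and Kan fibrations -/

section WeakHomotopyEquivalences

open MonoidalCategory CartesianMonoidalCategory SSet.modelCategoryQuillen

/-- The inclusion `X ⟶ X ⊗ Δ[1]` at the vertex `e` of `Δ[1]`. It treats both ends of a homotopy
uniformly. -/
def endpointInclusion (X : SSet.{w}) (e : Fin 2) : X ⟶ X ⊗ Δ[1] :=
  lift (𝟙 X) (SSet.const (SSet.stdSimplex.obj₀Equiv.{w}.symm e))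

lemma endpointInclusion_whiskerRight_assoc {X Y Z : SSet.{w}} (f : X ⟶ Y) (e : Fin 2)
    (g : Y ⊗ Δ[1] ⟶ Z) :
    endpointInclusion X e ≫ f ▷ _ ≫ g = f ≫ endpointInclusion Y e ≫ g := rfl

lemma nonempty_homotopy_iff {X Z : SSet.{w}} (a b : X ⟶ Z) :
    Nonempty (SSet.Homotopy a b) ↔ ∃ H : X ⊗ Δ[1] ⟶ Z,
      endpointInclusion X 0 ≫ H = a ∧ endpointInclusion X 1 ≫ H = b := by
  constructor
  · rintro ⟨H⟩
    exact ⟨H.h, H.h₀, H.h₁⟩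
  · rintro ⟨H, h₀, h₁⟩
    have rel : (⊥ : X.Subcomplex).ι ▷ Δ[1] ≫ H =
        fst _ _ ≫ SSet.Subcomplex.isInitialBot.to (⊥ : Z.Subcomplex) ≫ (⊥ : Z.Subcomplex).ι := by
      ext m x
      exact x.1.2.elim
    exact ⟨{ h := H, h₀ := h₀, h₁ := h₁, rel := rel }⟩

namespace HomotopyClasses

/-- The homotopy class of a map. -/
def mk {X Z : SSet.{w}} (a : X ⟶ Z) : HomotopyClasses X Z := Quot.mk _ a

lemma mk_surjective {X Z : SSet.{w}} : Function.Surjective (mk : (X ⟶ Z) → _) :=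
  Quot.mk_surjective

lemma mk_endpointInclusion {X Z : SSet.{w}} (H : X ⊗ Δ[1] ⟶ Z) (e : Fin 2) :
    mk (endpointInclusion X e ≫ H) = mk (endpointInclusion X (1 - e) ≫ H) := by
  have h : mk (endpointInclusion X 0 ≫ H) = mk (endpointInclusion X 1 ≫ H) :=
    Quot.sound ((nonempty_homotopy_iff _ _).2 ⟨H, rfl, rfl⟩)
  fin_cases e
  exacts [h, h.symm]

lemma iff_of_mk_eq_mk {X Z : SSet.{w}} {P : (X ⟶ Z) → Prop}
    (hP : ∀ (H : X ⊗ Δ[1] ⟶ Z) (e : Fin 2),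
      P (endpointInclusion X e ≫ H) → P (endpointInclusion X (1 - e) ≫ H))
    {a b : X ⟶ Z} (hab : mk a = mk b) : P a ↔ P b := by
  have hP' (a b : X ⟶ Z) (h : Nonempty (SSet.Homotopy a b)) : P a = P b := by
    obtain ⟨H, rfl, rfl⟩ := (nonempty_homotopy_iff _ _).1 h
    exact propext ⟨hP H 0, hP H 1⟩
  exact iff_of_eq (congrArg (Quot.lift P hP') hab)

/-- Postcomposition with `g` on homotopy classes. -/
def postcomp (X : SSet.{w}) {Z Z' : SSet.{w}} (g : Z ⟶ Z') :
    HomotopyClasses X Z → HomotopyClasses X Z' :=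
  Quot.map (fun a ↦ a ≫ g) (fun a b h ↦ by
    obtain ⟨H, rfl, rfl⟩ := (nonempty_homotopy_iff a b).1 h
    exact (nonempty_homotopy_iff _ _).2 ⟨H ≫ g, rfl, rfl⟩)

lemma precomp_mk {X Y Z : SSet.{w}} (f : X ⟶ Y) (a : Y ⟶ Z) :
    precomp f Z (mk a) = mk (f ≫ a) := rfl

lemma mk_comp_left {X Y Z : SSet.{w}} (f : X ⟶ Y) {a b : Y ⟶ Z} (h : mk a = mk b) :
    mk (f ≫ a) = mk (f ≫ b) :=
  congrArg (precomp f Z) h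

lemma mk_comp_right {X Z Z' : SSet.{w}} {a b : X ⟶ Z} (h : mk a = mk b) (g : Z ⟶ Z') :
    mk (a ≫ g) = mk (b ≫ g) :=
  congrArg (postcomp X g) h

lemma precomp_comp {X Y Z : SSet.{w}} (f : X ⟶ Y) (g : Y ⟶ Z) (T : SSet.{w}) :
    precomp (f ≫ g) T = precomp f T ∘ precomp g T := by
  funext x
  obtain ⟨a, rfl⟩ := mk_surjective x
  exact congrArg mk (Category.assoc f g a)

lemma precomp_bijective_of_mk_comp_eq {X Y : SSet.{w}} {f : X ⟶ Y} {g : Y ⟶ X}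
    (hfg : mk (f ≫ g) = mk (𝟙 X)) (hgf : mk (g ≫ f) = mk (𝟙 Y)) (T : SSet.{w}) :
    Function.Bijective (precomp f T) := by
  refine Function.bijective_iff_has_inverse.2 ⟨precomp g T, fun x ↦ ?_, fun x ↦ ?_⟩
  · obtain ⟨a, rfl⟩ := mk_surjective x
    simpa only [precomp_mk, Category.assoc, Category.id_comp] using mk_comp_right hgf a
  · obtain ⟨a, rfl⟩ := mk_surjective x
    simpa only [precomp_mk, Category.assoc, Category.id_comp] using mk_comp_right hfg a

end HomotopyClasses

/-- The weak homotopy equivalences, as a class of morphisms. -/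
def weakHomotopyEquivalences : MorphismProperty SSet.{w} :=
  fun _ _ f ↦ IsWeakHomotopyEquivalence f

instance : weakHomotopyEquivalences.{w}.HasTwoOutOfThreeProperty where
  comp_mem f g hf hg Z hZ := by
    rw [HomotopyClasses.precomp_comp]
    exact (hf Z hZ).comp (hg Z hZ)
  of_postcomp f g hg hfg Z hZ := by
    have := hfg Z hZ
    rw [HomotopyClasses.precomp_comp] at this
    exact (Function.Bijective.of_comp_iff _ (hg Z hZ)).1 this
  of_precomp f g hf hfg Z hZ := by
    have := hfg Z hZ
    rw [HomotopyClasses.precomp_comp] at this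
    exact (Function.Bijective.of_comp_iff' (hf Z hZ) _).1 this

lemma isWeakHomotopyEquivalence_of_isIso {X Y : SSet.{w}} (f : X ⟶ Y) [IsIso f] :
    IsWeakHomotopyEquivalence f := fun Z _ ↦
  HomotopyClasses.precomp_bijective_of_mk_comp_eq
    (congrArg HomotopyClasses.mk (IsIso.hom_inv_id f))
    (congrArg HomotopyClasses.mk (IsIso.inv_hom_id f)) Z

instance : weakHomotopyEquivalences.{w}.ContainsIdentities where
  id_mem X := isWeakHomotopyEquivalence_of_isIso (𝟙 X)

lemma horn_one_ι (e : Fin 2) :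
    (SSet.horn.{w} 1 e).ι = SSet.const (SSet.stdSimplex.obj₀Equiv.{w}.symm e) := by
  ext m x
  induction m using Opposite.rec with | _ m
  induction m using SimplexCategory.rec with | _ m
  obtain ⟨x, hx⟩ := x
  rw [SSet.mem_horn_iff_notMem_range] at hx
  obtain ⟨j, hj, hx⟩ := hx
  apply SSet.stdSimplex.ext
  intro i
  change x i = e
  have : x i ≠ j := fun h ↦ hx ⟨i, h⟩
  lia

lemma range_const_le_horn_one (L : SSet.{w}) (e : Fin 2) :
    SSet.Subcomplex.range (SSet.const (X := L) (SSet.stdSimplex.obj₀Equiv.{w}.symm e)) ≤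
      SSet.horn.{w} 1 e := by
  rintro m _ ⟨y, rfl⟩
  induction m using Opposite.rec with | _ m
  induction m using SimplexCategory.rec with | _ m
  rw [SSet.mem_horn_iff_notMem_range]
  refine ⟨1 - e, by lia, ?_⟩
  rintro ⟨i, hi⟩
  change e = 1 - e at hi
  lia

/-- The map `L ⟶ L ⊗ Λ[1, e]` through which `endpointInclusion L e` factors. -/
def endpointToHorn (L : SSet.{w}) (e : Fin 2) : L ⟶ L ⊗ (SSet.horn.{w} 1 e : SSet.{w}) :=
  lift (𝟙 L) (SSet.Subcomplex.lift _ (range_const_le_horn_one L e))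

lemma endpointToHorn_whiskerLeft_ι (L : SSet.{w}) (e : Fin 2) :
    endpointToHorn L e ≫ L ◁ (SSet.horn.{w} 1 e).ι = endpointInclusion L e := rfl

lemma whiskerLeft_horn_one_ι (L : SSet.{w}) (e : Fin 2) :
    L ◁ (SSet.horn.{w} 1 e).ι = fst _ _ ≫ endpointInclusion L e := by
  rw [horn_one_ι]
  rfl

lemma exists_homotopy_lift {L E B : SSet.{w}} (S : L.Subcomplex) (p : E ⟶ B) [Fibration p]
    (e : Fin 2) (V : L ⊗ Δ[1] ⟶ B) (U : (S : SSet.{w}) ⊗ Δ[1] ⟶ E) (x : L ⟶ E)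
    (hUV : S.ι ▷ _ ≫ V = U ≫ p) (hV : endpointInclusion L e ≫ V = x ≫ p)
    (hU : S.ι ≫ x = endpointInclusion _ e ≫ U) :
    ∃ W : L ⊗ Δ[1] ⟶ E, W ≫ p = V ∧ S.ι ▷ _ ≫ W = U ∧ endpointInclusion L e ≫ W = x := by
  let Λ := SSet.horn.{w} 1 e
  have := SSet.anodyneExtensions_unionProd_ι S Λ (SSet.anodyneExtensions.horn_ι e) p
    ((HomotopicalAlgebra.fibration_iff p).1 inferInstance)
  have hpo := SSet.Subcomplex.unionProd.isPushout S Λ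
  have compat : S.ι ▷ (Λ : SSet.{w}) ≫ fst _ _ ≫ x = (S : SSet.{w}) ◁ Λ.ι ≫ U := by
    rw [whiskerLeft_horn_one_ι, Category.assoc, ← hU]
    rfl
  have sq : CommSq (hpo.desc (fst _ _ ≫ x) U compat) (S.unionProd Λ).ι p V := ⟨by
    apply hpo.hom_ext
    · rw [hpo.inl_desc_assoc, SSet.Subcomplex.unionProd.ι₁_ι_assoc, whiskerLeft_horn_one_ι,
        Category.assoc, Category.assoc, hV]
    · rw [hpo.inr_desc_assoc, SSet.Subcomplex.unionProd.ι₂_ι_assoc, hUV]⟩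
  refine ⟨sq.lift, sq.fac_right, ?_, ?_⟩
  · rw [← SSet.Subcomplex.unionProd.ι₂_ι_assoc S Λ, sq.fac_left, hpo.inr_desc]
  · rw [← endpointToHorn_whiskerLeft_ι, Category.assoc,
      ← SSet.Subcomplex.unionProd.ι₁_ι_assoc S Λ, sq.fac_left, hpo.inl_desc]
    rfl

lemma bicartSq_range_endpointInclusion (X : SSet.{w}) :
    SSet.Subcomplex.BicartSq ⊥ (SSet.Subcomplex.range (endpointInclusion X 0))
      (SSet.Subcomplex.range (endpointInclusion X 1))
      (SSet.Subcomplex.range (endpointInclusion X 0) ⊔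
        SSet.Subcomplex.range (endpointInclusion X 1)) where
  sup_eq := rfl
  inf_eq := by
    rw [eq_bot_iff]
    rintro ⟨m⟩ _ ⟨⟨x, rfl⟩, ⟨y, hy⟩⟩
    induction m using SimplexCategory.rec with | _ m
    have h : (1 : Fin 2) = 0 := DFunLike.congr_fun (congrArg Prod.snd hy) (0 : Fin (m + 1))
    exact absurd h (by decide)

lemma nonempty_homotopy_of_rlp {X E B : SSet.{w}} {q : E ⟶ B} (hq : I.rlp q) {a b : X ⟶ E}
    (h : a ≫ q = b ≫ q) : Nonempty (SSet.Homotopy a b) := by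
  rw [nonempty_homotopy_iff]
  rw [← SSet.rlp_monomorphisms] at hq
  let R (e : Fin 2) := SSet.Subcomplex.range (endpointInclusion X e)
  have hpo := (bicartSq_range_endpointInclusion X).isPushout
  let ends : ((R 0 ⊔ R 1 : (X ⊗ Δ[1] : SSet.{w}).Subcomplex) : SSet.{w}) ⟶ E :=
    hpo.desc ((R 0).ι ≫ fst _ _ ≫ a) ((R 1).ι ≫ fst _ _ ≫ b)
      (SSet.Subcomplex.isInitialBot.hom_ext _ _)
  have := hq (R 0 ⊔ R 1).ι inferInstance
  have sq : CommSq ends (R 0 ⊔ R 1).ι q (fst _ _ ≫ a ≫ q) := ⟨by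
    apply hpo.hom_ext
    · rw [hpo.inl_desc_assoc, Category.assoc, Category.assoc]
      rfl
    · rw [hpo.inr_desc_assoc, Category.assoc, Category.assoc, h]
      rfl⟩
  have hends (e : Fin 2) (he : R e ≤ R 0 ⊔ R 1) : endpointInclusion X e ≫ sq.lift =
      SSet.Subcomplex.toRange (endpointInclusion X e) ≫ SSet.Subcomplex.homOfLE he ≫ ends :=
    congrArg (fun f ↦ SSet.Subcomplex.toRange (endpointInclusion X e) ≫
      SSet.Subcomplex.homOfLE he ≫ f) sq.fac_left
  refine ⟨sq.lift, ?_, ?_⟩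
  · rw [hends 0 le_sup_left, hpo.inl_desc]
    rfl
  · rw [hends 1 le_sup_right, hpo.inr_desc]
    rfl

lemma exists_section_of_rlp {E B : SSet.{w}} {q : E ⟶ B} (hq : I.rlp q) :
    ∃ s : B ⟶ E, s ≫ q = 𝟙 B := by
  rw [← SSet.rlp_monomorphisms] at hq
  have := hq (⊥ : B.Subcomplex).ι inferInstance
  have sq : CommSq (SSet.Subcomplex.isInitialBot.to E) (⊥ : B.Subcomplex).ι q (𝟙 B) :=
    ⟨SSet.Subcomplex.isInitialBot.hom_ext _ _⟩
  exact ⟨sq.lift, sq.fac_right⟩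

lemma isWeakHomotopyEquivalence_of_rlp {E B : SSet.{w}} {q : E ⟶ B} (hq : I.rlp q) :
    IsWeakHomotopyEquivalence q := fun Z _ ↦ by
  obtain ⟨s, hs⟩ := exists_section_of_rlp hq
  have hqs : HomotopyClasses.mk (q ≫ s) = HomotopyClasses.mk (𝟙 E) :=
    Quot.sound (nonempty_homotopy_of_rlp hq
      (by rw [Category.assoc, hs, Category.comp_id, Category.id_comp]))
  exact HomotopyClasses.precomp_bijective_of_mk_comp_eq hqs (congrArg HomotopyClasses.mk hs) Z

lemma exists_section_of_mk_comp_eq_mk_id {E B : SSet.{w}} (q : E ⟶ B) [Fibration q] {s : B ⟶ E}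
    (hs : HomotopyClasses.mk (s ≫ q) = HomotopyClasses.mk (𝟙 B)) :
    ∃ s' : B ⟶ E, s' ≫ q = 𝟙 B ∧ HomotopyClasses.mk s = HomotopyClasses.mk s' := by
  refine (HomotopyClasses.iff_of_mk_eq_mk (fun H e ↦ ?_) hs
    (P := fun b ↦ ∃ s' : B ⟶ E, s' ≫ q = b ∧ HomotopyClasses.mk s = HomotopyClasses.mk s')).1
      ⟨s, rfl, rfl⟩
  rintro ⟨s', hs', hss'⟩
  let emptyHomotopy : ((⊥ : B.Subcomplex) : SSet.{w}) ⊗ Δ[1] ⟶ E :=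
    fst _ _ ≫ SSet.Subcomplex.isInitialBot.to E
  obtain ⟨W, hW, -, rfl⟩ := exists_homotopy_lift (⊥ : B.Subcomplex) q e H emptyHomotopy s'
    (by ext m x; exact x.1.2.elim) hs'.symm (SSet.Subcomplex.isInitialBot.hom_ext _ _)
  exact ⟨endpointInclusion B (1 - e) ≫ W, by rw [Category.assoc, hW],
    hss'.trans (HomotopyClasses.mk_endpointInclusion W e)⟩

lemma exists_lift_of_homotopy {L E B : SSet.{w}} (S : L.Subcomplex) (q : E ⟶ B) [Fibration q]
    [SSet.KanComplex B] (H : (S : SSet.{w}) ⊗ Δ[1] ⟶ E) (e : Fin 2)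
    (he : ∀ v : L ⟶ B, S.ι ≫ v = (endpointInclusion _ e ≫ H) ≫ q →
      ∃ l : L ⟶ E, S.ι ≫ l = endpointInclusion _ e ≫ H ∧ l ≫ q = v)
    (v : L ⟶ B) (hv : S.ι ≫ v = (endpointInclusion _ (1 - e) ≫ H) ≫ q) :
    ∃ l : L ⟶ E, S.ι ≫ l = endpointInclusion _ (1 - e) ≫ H ∧ l ≫ q = v := by
  obtain ⟨V, -, hVH, hVv⟩ := exists_homotopy_lift S (terminal.from B) (1 - e)
    (terminal.from _) (H ≫ q) v (Subsingleton.elim _ _) (Subsingleton.elim _ _)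
    (by rw [hv, Category.assoc])
  obtain ⟨l, hlS, hlq⟩ := he (endpointInclusion _ e ≫ V) (by
    rw [← endpointInclusion_whiskerRight_assoc, hVH, Category.assoc])
  obtain ⟨W, hWV, hWH, -⟩ := exists_homotopy_lift S q e V H l hVH hlq.symm hlS
  refine ⟨endpointInclusion _ (1 - e) ≫ W, ?_, by rw [Category.assoc, hWV, hVv]⟩
  rw [← endpointInclusion_whiskerRight_assoc, hWH]

lemma rlp_of_isWeakHomotopyEquivalence {E B : SSet.{w}} (q : E ⟶ B) [Fibration q]
    [hE : SSet.KanComplex E] [hB : SSet.KanComplex B] (hq : IsWeakHomotopyEquivalence q) :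
    I.rlp q := by
  obtain ⟨s, hs⟩ : ∃ s : B ⟶ E, HomotopyClasses.mk (q ≫ s) = HomotopyClasses.mk (𝟙 E) := by
    obtain ⟨x, hx⟩ := (hq E hE).2 (HomotopyClasses.mk (𝟙 E))
    obtain ⟨s, rfl⟩ := HomotopyClasses.mk_surjective x
    exact ⟨s, hx⟩
  have hs' : HomotopyClasses.mk (s ≫ q) = HomotopyClasses.mk (𝟙 B) := by
    apply (hq B hB).1
    simpa only [HomotopyClasses.precomp_mk, Category.assoc, Category.id_comp, Category.comp_id]
      using HomotopyClasses.mk_comp_right hs q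
  obtain ⟨t, ht, hst⟩ := exists_section_of_mk_comp_eq_mk_id q hs'
  have ht' : HomotopyClasses.mk (q ≫ t) = HomotopyClasses.mk (𝟙 E) :=
    (HomotopyClasses.mk_comp_left q hst).symm.trans hs
  -- Up to homotopy the left side `u` of a square factors through `t`, where a filler is evident.
  rintro _ _ _ ⟨n⟩
  refine ⟨fun {u v} sq ↦ ?_⟩
  let P (a : (∂Δ[n] : SSet.{w}) ⟶ E) : Prop := ∀ b : Δ[n] ⟶ B, (SSet.boundary n).ι ≫ b = a ≫ q →
    ∃ l : Δ[n] ⟶ E, (SSet.boundary n).ι ≫ l = a ∧ l ≫ q = b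
  have hP : P (u ≫ q ≫ t) := fun b hb ↦ ⟨b ≫ t, by
    simp only [Category.assoc, ht, Category.comp_id] at hb
    rw [← Category.assoc, hb, Category.assoc], by rw [Category.assoc, ht, Category.comp_id]⟩
  have hu : HomotopyClasses.mk (u ≫ q ≫ t) = HomotopyClasses.mk u := by
    simpa only [Category.comp_id] using HomotopyClasses.mk_comp_left u ht'
  obtain ⟨l, hl, hl'⟩ := (HomotopyClasses.iff_of_mk_eq_mk
    (exists_lift_of_homotopy (SSet.boundary n) q) hu).1 hP v sq.w.symm
  exact ⟨⟨⟨l, hl, hl'⟩⟩⟩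

lemma isWeakHomotopyEquivalence_iff_rlp {E B : SSet.{w}} (q : E ⟶ B) [Fibration q]
    [SSet.KanComplex E] [SSet.KanComplex B] : IsWeakHomotopyEquivalence q ↔ I.rlp q :=
  ⟨rlp_of_isWeakHomotopyEquivalence q, isWeakHomotopyEquivalence_of_rlp⟩

end WeakHomotopyEquivalences

/-! ### Unions of facets of the standard simplex -/

section Facets

/-- The comparison map from the inverse image of a subcomplex under `δ` to its intersection with
the range of `δ`. -/
def preimageToInfRange {D X : SSet.{w}} (δ : D ⟶ X) (U : X.Subcomplex) :
    ((U.preimage δ : D.Subcomplex) : SSet.{w}) ⟶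
      ((U ⊓ SSet.Subcomplex.range δ : X.Subcomplex) : SSet.{w}) :=
  SSet.Subcomplex.lift ((U.preimage δ).ι ≫ δ) (by
    rintro m _ ⟨⟨x, hx⟩, rfl⟩
    exact ⟨hx, ⟨x, rfl⟩⟩)

instance isIso_preimageToInfRange {D X : SSet.{w}} (δ : D ⟶ X) [Mono δ] (U : X.Subcomplex) :
    IsIso (preimageToInfRange δ U) := by
  have injective (m) : Function.Injective (δ.app m) := by
    rw [← mono_iff_injective]
    infer_instance
  rw [NatTrans.isIso_iff_isIso_app]
  intro m
  rw [isIso_iff_bijective]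
  constructor
  · exact fun x y hxy ↦ Subtype.ext (injective m (congrArg Subtype.val hxy))
  · rintro ⟨_, hx, ⟨y, rfl⟩⟩
    exact ⟨⟨y, hx⟩, rfl⟩

lemma isPushout_preimage {D X : SSet.{w}} (δ : D ⟶ X) [Mono δ] (U V : X.Subcomplex)
    (h : U ⊔ SSet.Subcomplex.range δ = V) :
    IsPushout (U.preimage δ).ι (U.fromPreimage δ)
      (SSet.Subcomplex.lift δ (le_sup_right.trans h.le))
      (SSet.Subcomplex.homOfLE (le_sup_left.trans h.le)) := by
  have sq : SSet.Subcomplex.BicartSq (U ⊓ SSet.Subcomplex.range δ) (SSet.Subcomplex.range δ) U V :=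
    { sup_eq := by rw [← h, sup_comm]
      inf_eq := inf_comm _ _ }
  exact IsPushout.of_iso' sq.isPushout (asIso (preimageToInfRange δ U))
    (asIso (SSet.Subcomplex.toRange δ)) (Iso.refl _) (Iso.refl _) rfl rfl rfl rfl

/-- The union of the facets of `Δ[n]` opposite to the vertices in `S`. -/
def facets (n : ℕ) (S : Set (Fin (n + 1))) : (Δ[n] : SSet.{w}).Subcomplex where
  obj m := {σ | ∃ i ∈ S, i ∉ Set.range (SSet.stdSimplex.asOrderHom σ)}
  map f σ := by
    rintro ⟨i, hi, h⟩
    refine ⟨i, hi, fun ⟨j, hj⟩ ↦ h ⟨f.unop.toOrderHom j, hj⟩⟩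

lemma facets_univ (n : ℕ) : facets.{w} n Set.univ = SSet.boundary n := by
  ext m σ
  change (∃ i ∈ _, _) ↔ ¬ Function.Surjective _
  simp [Function.Surjective]

lemma facets_compl_singleton (n : ℕ) (k : Fin (n + 1)) :
    facets.{w} n {k}ᶜ = SSet.horn n k := by
  ext m σ
  change (∃ i ∈ _, _) ↔ _ ≠ _
  rw [Set.ne_univ_iff_exists_notMem]
  simp

lemma facets_empty (n : ℕ) : facets.{w} n ∅ = ⊥ := by
  rw [eq_bot_iff]
  rintro m σ ⟨i, hi, -⟩
  exact hi.elim

lemma facets_mono {n : ℕ} {S T : Set (Fin (n + 1))} (h : S ⊆ T) :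
    facets.{w} n S ≤ facets n T := fun _ _ ⟨i, hi, hi'⟩ ↦ ⟨i, h hi, hi'⟩

lemma preimage_facets {n : ℕ} (S : Set (Fin (n + 2))) (i : Fin (n + 2)) (hi : i ∉ S) :
    (facets.{w} (n + 1) S).preimage (SSet.stdSimplex.δ i) = facets n (i.succAbove ⁻¹' S) := by
  ext m σ
  constructor
  · rintro ⟨j, hj, h⟩
    obtain ⟨j, rfl⟩ := Fin.exists_succAbove_eq (x := j) (y := i) (by rintro rfl; exact hi hj)
    exact ⟨j, hj, fun ⟨k, hk⟩ ↦ h ⟨k, congrArg i.succAbove hk⟩⟩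
  · rintro ⟨j, hj, h⟩
    exact ⟨_, hj, fun ⟨k, hk⟩ ↦ h ⟨k, Fin.succAbove_right_injective hk⟩⟩

lemma range_δ_le_facets {n : ℕ} {S : Set (Fin (n + 2))} {i : Fin (n + 2)} (hi : i ∈ S) :
    SSet.Subcomplex.range (SSet.stdSimplex.δ i) ≤ facets.{w} (n + 1) S := by
  rintro m _ ⟨σ, rfl⟩
  exact ⟨i, hi, fun ⟨k, hk⟩ ↦ Fin.succAbove_ne _ _ hk⟩

lemma facets_sup_range_δ {n : ℕ} (S : Set (Fin (n + 2))) (i : Fin (n + 2)) :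
    facets.{w} (n + 1) S ⊔ SSet.Subcomplex.range (SSet.stdSimplex.δ i) =
      facets (n + 1) (insert i S) := by
  apply le_antisymm
  · exact sup_le (facets_mono (Set.subset_insert _ _)) (range_δ_le_facets (Set.mem_insert _ _))
  · rintro m σ ⟨j, hj | hj, h⟩
    · subst hj
      refine Or.inr ?_
      induction m using Opposite.rec with | _ m
      induction m using SimplexCategory.rec with | _ m
      have : ∀ k, ∃ l, j.succAbove l = σ k := fun k ↦
        Fin.exists_succAbove_eq (fun hk ↦ h ⟨k, hk⟩)
      choose f hf using this
      refine ⟨SSet.stdSimplex.objMk ⟨f, fun a b hab ↦ ?_⟩, ?_⟩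
      · rw [← (Fin.strictMono_succAbove j).le_iff_le, hf, hf]
        exact SSet.stdSimplex.monotone_apply σ hab
      · apply SSet.stdSimplex.ext
        exact hf
    · exact Or.inl ⟨j, hj, h⟩

/-- The facet `i` as a map to a union of facets which contains it. -/
def facetMap {n : ℕ} {S : Set (Fin (n + 2))} {i : Fin (n + 2)} (hi : i ∈ S) :
    (Δ[n] : SSet.{w}) ⟶ facets.{w} (n + 1) S :=
  SSet.Subcomplex.lift (SSet.stdSimplex.δ i) (range_δ_le_facets hi)

/-- The restriction of the facet `i` to a union of facets. -/
def facetRestriction {n : ℕ} (S : Set (Fin (n + 2))) (i : Fin (n + 2)) (hi : i ∉ S) :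
    (facets.{w} n (i.succAbove ⁻¹' S) : SSet.{w}) ⟶ facets.{w} (n + 1) S :=
  SSet.Subcomplex.lift ((facets n _).ι ≫ SSet.stdSimplex.δ i) (by
    rintro m _ ⟨⟨σ, hσ⟩, rfl⟩
    rwa [← preimage_facets S i hi] at hσ)

lemma isPushout_facets {n : ℕ} (S : Set (Fin (n + 2))) (i : Fin (n + 2)) (hi : i ∉ S) :
    IsPushout (facets.{w} n (i.succAbove ⁻¹' S)).ι (facetRestriction S i hi)
      (facetMap (Set.mem_insert i S))
      (SSet.Subcomplex.homOfLE (facets_mono (Set.subset_insert i S))) := by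
  have : Mono (SSet.stdSimplex.{w}.δ i) := inferInstance
  refine (isPushout_preimage (SSet.stdSimplex.δ i) (facets.{w} (n + 1) S) _
    (facets_sup_range_δ S i)).of_iso
    (SSet.Subcomplex.eqToIso (preimage_facets S i hi)) (Iso.refl _) (Iso.refl _) (Iso.refl _)
    rfl rfl rfl rfl

/-- The restriction of the facet `i` to a map from the boundary of the facet to the horn which
omits this facet. -/
def boundaryToHorn {n : ℕ} (i : Fin (n + 2)) : (∂Δ[n] : SSet.{w}) ⟶ Λ[n + 1, i] :=
  SSet.Subcomplex.lift ((SSet.boundary n).ι ≫ SSet.stdSimplex.δ i) (by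
    rw [← facets_compl_singleton, ← facets_univ]
    rintro m _ ⟨⟨σ, j, -, hj⟩, rfl⟩
    exact ⟨i.succAbove j, Fin.succAbove_ne i j,
      fun ⟨k, hk⟩ ↦ hj ⟨k, Fin.succAbove_right_injective hk⟩⟩)

lemma horn_le_boundary {n : ℕ} (i : Fin (n + 1)) : SSet.horn.{w} n i ≤ SSet.boundary n := by
  rw [← facets_compl_singleton, ← facets_univ]
  exact facets_mono (Set.subset_univ _)

lemma isPushout_boundary_horn {n : ℕ} (i : Fin (n + 2)) :
    IsPushout (SSet.boundary.{w} n).ι (boundaryToHorn i) (SSet.boundary.ι i)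
      (SSet.Subcomplex.homOfLE (horn_le_boundary i)) := by
  have preimage_eq : i.succAbove ⁻¹' {i}ᶜ = Set.univ := by ext; simp
  have insert_eq : insert i ({i}ᶜ : Set (Fin (n + 2))) = Set.univ := by ext; simp [em]
  exact (isPushout_facets {i}ᶜ i (by simp)).of_iso
    (SSet.Subcomplex.eqToIso (by rw [preimage_eq, facets_univ])) (Iso.refl _)
    (SSet.Subcomplex.eqToIso (facets_compl_singleton _ i))
    (SSet.Subcomplex.eqToIso (by rw [insert_eq, facets_univ])) rfl rfl rfl rfl

lemma isIso_facetMap_singleton {n : ℕ} (i : Fin (n + 2)) :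
    IsIso (facetMap.{w} (Set.mem_singleton i)) := by
  have h₁ : IsInitial (facets.{w} n (i.succAbove ⁻¹' ∅) : SSet.{w}) := by
    rw [Set.preimage_empty, facets_empty]
    exact SSet.Subcomplex.isInitialBot
  have h₂ : IsInitial (facets.{w} (n + 1) ∅ : SSet.{w}) := by
    rw [facets_empty]
    exact SSet.Subcomplex.isInitialBot
  have : IsIso (facetRestriction.{w} ∅ i (Set.notMem_empty i)) :=
    isIso_of_isInitial h₁ h₂ _
  have := (isPushout_facets.{w} ∅ i (Set.notMem_empty i)).isIso_inl_of_isIso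
  convert this using 2 <;> simp

lemma facets_induction {P : ∀ n : ℕ, Set (Fin (n + 1)) → Prop} (empty : P 0 ∅)
    (univ : ∀ n : ℕ, P n Set.univ)
    (of_insert : ∀ (n : ℕ) (S : Set (Fin (n + 2))) (i : Fin (n + 2)), i ∉ S →
      P n (i.succAbove ⁻¹' S) → P (n + 1) (insert i S) → P (n + 1) S)
    (n : ℕ) (S : Set (Fin (n + 1))) : P n S := by
  induction n with
  | zero =>
    obtain rfl | hS := S.eq_empty_or_nonempty
    · exact empty
    · rw [Subsingleton.eq_univ_of_nonempty (α := Fin 1) hS]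
      exact univ 0
  | succ n hn =>
    suffices ∀ T : Set (Fin (n + 2)), P (n + 1) Tᶜ from compl_compl S ▸ this Sᶜ
    intro T
    induction T, T.toFinite using Set.Finite.induction_on with
    | empty => exact Set.compl_empty ▸ univ _
    | @insert i T hi _ hT =>
      refine of_insert n _ i (by simp) (hn _) ?_
      have : insert i (insert i T)ᶜ = Tᶜ := by
        ext j
        obtain rfl | hj := eq_or_ne j i <;> simp [*]
      rwa [this]

lemma proper_facets_induction {P : ∀ n : ℕ, Set (Fin (n + 1)) → Prop}
    (singleton : ∀ (n : ℕ) (i : Fin (n + 2)), P (n + 1) {i})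
    (insert : ∀ (n : ℕ) (S : Set (Fin (n + 2))) (i : Fin (n + 2)), i ∉ S →
      P n (i.succAbove ⁻¹' S) → P (n + 1) S → P (n + 1) (insert i S))
    (n : ℕ) (S : Set (Fin (n + 1))) (hS : S.Nonempty) (hS' : S ≠ Set.univ) : P n S := by
  induction n with
  | zero => exact (hS' (Subsingleton.eq_univ_of_nonempty (α := Fin 1) hS)).elim
  | succ n hn =>
    induction S, S.toFinite using Set.Finite.induction_on with
    | empty => exact (Set.not_nonempty_empty hS).elim
    | @insert i T hi _ hT =>
      obtain rfl | hT₀ := T.eq_empty_or_nonempty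
      · exact insert_empty_eq (β := Set (Fin (n + 2))) i ▸ singleton n i
      · have hT₁ : T ≠ Set.univ := (ne_of_mem_of_not_mem' (Set.mem_univ i) hi).symm
        refine insert n T i hi (hn _ ?_ ?_) (hT hT₀ hT₁)
        · obtain ⟨j, hj⟩ := hT₀
          obtain ⟨j, rfl⟩ := Fin.exists_succAbove_eq (ne_of_mem_of_not_mem hj hi)
          exact ⟨j, hj⟩
        · contrapose! hS'
          rw [Set.eq_univ_iff_forall] at hS' ⊢
          intro j
          obtain rfl | hj := eq_or_ne j i
          · exact Set.mem_insert _ _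
          · obtain ⟨j, rfl⟩ := Fin.exists_succAbove_eq hj
            exact Set.mem_insert_of_mem _ (hS' j)

end Facets

/-! ### The adjunction between tensors and singular complexes -/

section Tensor

variable {D : Type u} [Category.{w} D]

lemma yonedaEquiv_map_comp {L : SSet.{w}} {m m' : SimplexCategory} (f : m' ⟶ m)
    (x : SSet.stdSimplex.obj m ⟶ L) :
    SSet.yonedaEquiv (SSet.stdSimplex.map f ≫ x) = L.map f.op (SSet.yonedaEquiv x) := by
  refine Eq.trans ?_ (ConcreteCategory.congr_hom (x.naturality f.op)
    (SSet.stdSimplex.objEquiv.symm (𝟙 m)))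
  refine congrArg (x.app (op m')) (SSet.stdSimplex.objEquiv.injective ?_)
  exact (Category.id_comp f).trans (Category.comp_id f).symm

lemma map_comp_yonedaEquiv_symm {L : SSet.{w}} {m m' : SimplexCategory} (f : m' ⟶ m)
    (x : L.obj (op m)) :
    SSet.stdSimplex.map f ≫ SSet.yonedaEquiv.symm x = SSet.yonedaEquiv.symm (L.map f.op x) := by
  apply SSet.yonedaEquiv.injective
  rw [yonedaEquiv_map_comp, Equiv.apply_symm_apply, Equiv.apply_symm_apply]

/-- The simplicial set `D(A^•, X)`. -/
def singular (A : SimplexCategory ⥤ D) : D ⥤ SSet.{w} where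
  obj X := A.op ⋙ yoneda.obj X
  map f := Functor.whiskerLeft A.op (yoneda.map f)

/-- The map `D(A'^•, X) ⟶ D(A^•, X)` induced by `τ : A ⟶ A'`. -/
def singularTrans {A A' : SimplexCategory ⥤ D} (τ : A ⟶ A') :
    singular A' ⟶ singular A where
  app X := Functor.whiskerRight (NatTrans.op τ) (yoneda.obj X)
  naturality X Y f := by
    ext m x
    exact (Category.assoc (τ.app m.unop) x f).symm

variable [HasColimits D] (A : SimplexCategory ⥤ D)

/-- The map `A⁽ᵐ⁾ ⟶ A ⊗ L` which corresponds to a simplex `Δ[m] ⟶ L`. -/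
def tensorι {L : SSet.{w}} {m : SimplexCategory} (x : SSet.stdSimplex.obj m ⟶ L) :
    A.obj m ⟶ tensorObj A L :=
  colimit.ι (CostructuredArrow.proj simplexFunctor.{w} L ⋙ A)
    (CostructuredArrow.mk (S := simplexFunctor.{w}) x)

lemma map_tensorι {L : SSet.{w}} {m m' : SimplexCategory} (f : m' ⟶ m)
    (x : SSet.stdSimplex.obj m ⟶ L) :
    A.map f ≫ tensorι A x = tensorι A (SSet.stdSimplex.map f ≫ x) :=
  colimit.w (CostructuredArrow.proj simplexFunctor.{w} L ⋙ A)
    (CostructuredArrow.homMk (S := simplexFunctor.{w}) f rfl :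
      CostructuredArrow.mk (S := simplexFunctor.{w}) (SSet.stdSimplex.map f ≫ x) ⟶
        CostructuredArrow.mk (S := simplexFunctor.{w}) x)

variable {A} in
lemma tensorObj_hom_ext {L : SSet.{w}} {X : D} {f g : tensorObj A L ⟶ X}
    (h : ∀ (m : SimplexCategory) (x : SSet.stdSimplex.obj m ⟶ L),
      tensorι A x ≫ f = tensorι A x ≫ g) : f = g :=
  colimit.hom_ext (fun σ ↦ h σ.left σ.hom)

lemma tensorι_tensorMap {L L' : SSet.{w}} {m : SimplexCategory} (x : SSet.stdSimplex.obj m ⟶ L)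
    (f : L ⟶ L') : tensorι A x ≫ tensorMap A f = tensorι A (x ≫ f) :=
  colimit.ι_pre (CostructuredArrow.proj simplexFunctor.{w} L' ⋙ A) (CostructuredArrow.map f)
    (CostructuredArrow.mk (S := simplexFunctor.{w}) x)

lemma tensorι_tensorMap_assoc {L L' : SSet.{w}} {m : SimplexCategory}
    (x : SSet.stdSimplex.obj m ⟶ L) (f : L ⟶ L') {Z : D} (g : tensorObj A L' ⟶ Z) :
    tensorι A x ≫ tensorMap A f ≫ g = tensorι A (x ≫ f) ≫ g := by
  rw [← Category.assoc, tensorι_tensorMap]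

/-- Constructor for morphisms from `A ⊗ L`. -/
def tensorDesc {L : SSet.{w}} {X : D} (φ : L ⟶ (singular A).obj X) : tensorObj A L ⟶ X :=
  colimit.desc (CostructuredArrow.proj simplexFunctor.{w} L ⋙ A)
    { pt := X
      ι :=
        { app σ := φ.app (op σ.left) (SSet.yonedaEquiv σ.hom)
          naturality σ τ f := by
            have h : SSet.yonedaEquiv σ.hom = L.map f.left.op (SSet.yonedaEquiv τ.hom) := by
              rw [← CostructuredArrow.w f]
              exact yonedaEquiv_map_comp f.left τ.hom
            refine Eq.trans ?_ (Category.comp_id _).symm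
            rw [h]
            exact (ConcreteCategory.congr_hom (φ.naturality f.left.op)
              (SSet.yonedaEquiv τ.hom)).symm } }

lemma tensorι_tensorDesc {L : SSet.{w}} {X : D} (φ : L ⟶ (singular A).obj X)
    {m : SimplexCategory} (x : SSet.stdSimplex.obj m ⟶ L) :
    tensorι A x ≫ tensorDesc A φ = φ.app (op m) (SSet.yonedaEquiv x) :=
  colimit.ι_desc _ _

/-- Morphisms `A ⊗ L ⟶ X` correspond to morphisms `L ⟶ D(A^•, X)`. -/
def tensorHomEquiv (L : SSet.{w}) (X : D) :
    (tensorObj A L ⟶ X) ≃ (L ⟶ (singular A).obj X) where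
  toFun f :=
    { app m := ↾fun x ↦ tensorι A (SSet.yonedaEquiv.symm x) ≫ f
      naturality m m' g := by
        ext x
        change _ = A.map g.unop ≫ tensorι A (SSet.yonedaEquiv.symm x) ≫ f
        rw [← Category.assoc, map_tensorι, map_comp_yonedaEquiv_symm]
        rfl }
  invFun φ := tensorDesc A φ
  left_inv f := by
    apply tensorObj_hom_ext
    intro m x
    rw [tensorι_tensorDesc]
    change tensorι A (SSet.yonedaEquiv.symm (SSet.yonedaEquiv x)) ≫ f = _
    rw [Equiv.symm_apply_apply]
  right_inv φ := by
    ext m x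
    change tensorι A (SSet.yonedaEquiv.symm x) ≫ tensorDesc A φ = _
    rw [tensorι_tensorDesc, Equiv.apply_symm_apply]
    rfl

/-- The functor `L ↦ A ⊗ L`. -/
def tensorFunctor : SSet.{w} ⥤ D where
  obj := tensorObj A
  map f := tensorMap A f
  map_id L := by
    apply tensorObj_hom_ext
    intro m x
    rw [tensorι_tensorMap, Category.comp_id, Category.comp_id]
  map_comp f g := by
    apply tensorObj_hom_ext
    intro m x
    rw [tensorι_tensorMap, tensorι_tensorMap_assoc, tensorι_tensorMap, Category.assoc]

/-- The functor `A ⊗ -` is left adjoint to the functor `D(A^•, -)`. -/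
def tensorAdj : tensorFunctor A ⊣ singular A :=
  Adjunction.mkOfHomEquiv
    { homEquiv := tensorHomEquiv A
      homEquiv_naturality_left_symm f g := by
        apply tensorObj_hom_ext
        intro m x
        change tensorι A x ≫ tensorDesc A _ = tensorι A x ≫ tensorMap A f ≫ tensorDesc A g
        rw [tensorι_tensorMap_assoc, tensorι_tensorDesc, tensorι_tensorDesc]
        rfl
      homEquiv_naturality_right f g := by
        ext m x
        exact (Category.assoc _ _ _).symm }

instance : (tensorFunctor A).IsLeftAdjoint := ⟨_, ⟨tensorAdj A⟩⟩

section

variable {A} {B : SimplexCategory ⥤ D} (τ : A ⟶ B)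

/-- The map `A ⊗ L ⟶ B ⊗ L` induced by `A ⟶ B`. -/
def tensorTransApp (L : SSet.{w}) : tensorObj A L ⟶ tensorObj B L :=
  tensorDesc A (tensorHomEquiv B L _ (𝟙 _) ≫ (singularTrans τ).app _)

lemma tensorι_tensorTransApp {L : SSet.{w}} {m : SimplexCategory}
    (x : SSet.stdSimplex.obj m ⟶ L) :
    tensorι A x ≫ tensorTransApp τ L = τ.app m ≫ tensorι B x := by
  refine (tensorι_tensorDesc _ _ _).trans ?_
  change τ.app m ≫ tensorι B (SSet.yonedaEquiv.symm (SSet.yonedaEquiv x)) ≫ 𝟙 _ = _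
  rw [Equiv.symm_apply_apply, Category.comp_id]

lemma tensorι_tensorTransApp_assoc {L : SSet.{w}} {m : SimplexCategory}
    (x : SSet.stdSimplex.obj m ⟶ L) {Z : D} (f : tensorObj B L ⟶ Z) :
    tensorι A x ≫ tensorTransApp τ L ≫ f = τ.app m ≫ tensorι B x ≫ f := by
  rw [← Category.assoc, tensorι_tensorTransApp, Category.assoc]

lemma tensorMap_tensorTransApp {L L' : SSet.{w}} (f : L ⟶ L') :
    tensorMap A f ≫ tensorTransApp τ L' = tensorTransApp τ L ≫ tensorMap B f := by
  apply tensorObj_hom_ext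
  intro m x
  rw [tensorι_tensorMap_assoc, tensorι_tensorTransApp, tensorι_tensorTransApp_assoc,
    tensorι_tensorMap]

/-- The natural transformation `A ⊗ - ⟶ B ⊗ -` induced by `A ⟶ B`. -/
def tensorTrans : tensorFunctor A ⟶ tensorFunctor B where
  app L := tensorTransApp τ L
  naturality _ _ f := tensorMap_tensorTransApp τ f

end

lemma tensorTransApp_id (L : SSet.{w}) : tensorTransApp (𝟙 A) L = 𝟙 _ := by
  apply tensorObj_hom_ext
  intro m x
  rw [tensorι_tensorTransApp, NatTrans.id_app, Category.id_comp, Category.comp_id]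

variable {A} in
lemma tensorTransApp_comp {A' A'' : SimplexCategory ⥤ D} (τ : A ⟶ A') (τ' : A' ⟶ A'')
    (L : SSet.{w}) : tensorTransApp (τ ≫ τ') L = tensorTransApp τ L ≫ tensorTransApp τ' L := by
  apply tensorObj_hom_ext
  intro m x
  rw [tensorι_tensorTransApp, tensorι_tensorTransApp_assoc, tensorι_tensorTransApp,
    NatTrans.comp_app, Category.assoc]

/-- The isomorphism `A ⊗ Δ[m] ≅ A⁽ᵐ⁾`. -/
def tensorStdSimplexIso (m : SimplexCategory) :
    tensorObj A (SSet.stdSimplex.{w}.obj m) ≅ A.obj m where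
  hom := colimit.desc (CostructuredArrow.proj simplexFunctor.{w} (SSet.stdSimplex.{w}.obj m) ⋙ A)
    { pt := A.obj m
      ι :=
        { app σ := A.map (SSet.stdSimplex.fullyFaithful.preimage σ.hom)
          naturality σ τ f := by
            refine Eq.trans ?_ (Category.comp_id _).symm
            refine (A.map_comp _ _).symm.trans (congrArg A.map ?_)
            apply SSet.stdSimplex.{w}.map_injective
            refine (Functor.map_comp _ _ _).trans ?_
            refine (congrArg (SSet.stdSimplex.{w}.map f.left ≫ ·)
              (SSet.stdSimplex.fullyFaithful.map_preimage τ.hom)).trans ?_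
            exact (CostructuredArrow.w f).trans
              (SSet.stdSimplex.fullyFaithful.map_preimage σ.hom).symm } }
  inv := tensorι A (𝟙 _)
  hom_inv_id := by
    apply tensorObj_hom_ext
    intro k x
    refine ((Category.assoc _ _ _).symm.trans (congrArg (· ≫ tensorι A (𝟙 _))
      (colimit.ι_desc _ _))).trans ?_
    refine (map_tensorι A _ _).trans ?_
    rw [Category.comp_id, Category.comp_id]
    exact congrArg (tensorι A) (SSet.stdSimplex.fullyFaithful.map_preimage x)
  inv_hom_id := by
    refine (colimit.ι_desc _ _).trans ?_
    refine (congrArg A.map ?_).trans (A.map_id m)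
    apply SSet.stdSimplex.{w}.map_injective
    exact (SSet.stdSimplex.fullyFaithful.map_preimage _).trans
      (CategoryTheory.Functor.map_id _ _).symm

lemma tensorι_tensorStdSimplexIso_hom {m k : SimplexCategory} (f : k ⟶ m) :
    tensorι A (SSet.stdSimplex.{w}.map f) ≫ (tensorStdSimplexIso A m).hom = A.map f := by
  have h := map_tensorι A f (𝟙 (SSet.stdSimplex.{w}.obj m))
  rw [Category.comp_id] at h
  rw [← h, Category.assoc]
  exact (congrArg (A.map f ≫ ·) (tensorStdSimplexIso A m).inv_hom_id).trans (Category.comp_id _)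

lemma tensorStdSimplexIso_inv_tensorMap {m k : SimplexCategory} (f : k ⟶ m) :
    (tensorStdSimplexIso A k).inv ≫ tensorMap A (SSet.stdSimplex.{w}.map f) =
      A.map f ≫ (tensorStdSimplexIso A m).inv := by
  refine (tensorι_tensorMap A _ _).trans (Eq.trans ?_ (map_tensorι A _ _).symm)
  rw [Category.comp_id, Category.id_comp]

lemma latchingMap_eq (n : ℕ) :
    latchingMap A n =
      tensorMap A (SSet.boundary.{w} n).ι ≫ (tensorStdSimplexIso A ⦋n⦌).hom := by
  apply tensorObj_hom_ext
  intro m x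
  refine (colimit.ι_desc _ _).trans ?_
  rw [← Category.assoc, tensorι_tensorMap]
  refine Eq.trans ?_ (congrArg (· ≫ (tensorStdSimplexIso A ⦋n⦌).hom) (congrArg (tensorι A)
    (SSet.stdSimplex.fullyFaithful.map_preimage (x ≫ (SSet.boundary.{w} n).ι))))
  exact (tensorι_tensorStdSimplexIso_hom A _).symm

end Tensor

/-! ### Reedy cofibrant functors on simplicial sets -/

section Reedy

lemma weakEquivalence_of_isPushout {D : Type u} [Category.{w} D] [ModelCategory D]
    {X₁ X₂ X₃ X₄ : D} {f : X₁ ⟶ X₂} {g : X₁ ⟶ X₃} {h : X₂ ⟶ X₄} {k : X₃ ⟶ X₄}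
    (sq : IsPushout f g h k) [Cofibration f] [WeakEquivalence f] : WeakEquivalence k := by
  rw [weakEquivalence_iff]
  exact ((trivialCofibrations D).of_isPushout sq.flip (mem_trivialCofibrations f)).2

lemma cofibration_of_isPushout {D : Type u} [Category.{w} D] [ModelCategory D]
    {X₁ X₂ X₃ X₄ : D} {f : X₁ ⟶ X₂} {g : X₁ ⟶ X₃} {h : X₂ ⟶ X₄} {k : X₃ ⟶ X₄}
    (sq : IsPushout f g h k) [hf : Cofibration f] : Cofibration k := by
  rw [cofibration_iff] at hf ⊢
  exact (cofibrations D).of_isPushout sq.flip hf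

variable {D : Type u} [Category.{w} D]

section

variable [ModelCategory D] (F : SSet.{w} ⥤ D)

/-- A left adjoint functor on simplicial sets which corresponds to a Reedy cofibrant
homotopically constant cosimplicial object. -/
structure IsReedyCofibrantConstant : Prop where
  isLeftAdjoint : F.IsLeftAdjoint
  cofibration (n : ℕ) : Cofibration (F.map (SSet.boundary.{w} n).ι)
  weakEquivalence {m n : SimplexCategory} (f : m ⟶ n) :
    WeakEquivalence (F.map (SSet.stdSimplex.map f))

lemma cofibration_map_facets [F.IsLeftAdjoint]
    (hF : ∀ n : ℕ, Cofibration (F.map (SSet.boundary.{w} n).ι)) (n : ℕ) (S : Set (Fin (n + 1))) :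
    Cofibration (F.map (facets.{w} n S).ι) := by
  induction n, S using facets_induction with
  | empty =>
    rw [facets_empty, ← SSet.boundary_zero]
    exact hF 0
  | univ n =>
    rw [facets_univ]
    exact hF n
  | of_insert n S i hi _ _ =>
    have := cofibration_of_isPushout ((isPushout_facets S i hi).map F)
    have fac : F.map (facets.{w} (n + 1) S).ι =
        F.map (SSet.Subcomplex.homOfLE (facets_mono (Set.subset_insert i S))) ≫
          F.map (facets.{w} (n + 1) (insert i S)).ι := by
      rw [← F.map_comp, SSet.Subcomplex.homOfLE_ι]
    rw [fac]
    infer_instance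

lemma cofibration_map_horn [F.IsLeftAdjoint]
    (hF : ∀ n : ℕ, Cofibration (F.map (SSet.boundary.{w} n).ι)) (n : ℕ) (i : Fin (n + 1)) :
    Cofibration (F.map (SSet.horn.{w} n i).ι) :=
  facets_compl_singleton.{w} n i ▸ cofibration_map_facets F hF n {i}ᶜ

variable {F} in
lemma IsReedyCofibrantConstant.weakEquivalence_facets (hF : IsReedyCofibrantConstant F) (n : ℕ)
    (S : Set (Fin (n + 1))) (hS : S.Nonempty) (hS' : S ≠ Set.univ) :
    WeakEquivalence (F.map (facets.{w} n S).ι) := by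
  have := hF.isLeftAdjoint
  refine proper_facets_induction (P := fun n S ↦ WeakEquivalence (F.map (facets.{w} n S).ι))
    (fun n i ↦ ?_) (fun n S i hi _ _ ↦ ?_) n S hS hS'
  · have := isIso_facetMap_singleton.{w} i
    have fac : F.map (facetMap.{w} (Set.mem_singleton i)) ≫ F.map (facets.{w} (n + 1) {i}).ι =
        F.map (SSet.stdSimplex.map (SimplexCategory.δ i)) := by
      rw [← F.map_comp]
      rfl
    have := hF.weakEquivalence (SimplexCategory.δ i)
    exact weakEquivalence_of_precomp_of_fac fac
  · have := cofibration_map_facets F hF.cofibration n (i.succAbove ⁻¹' S)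
    have := weakEquivalence_of_isPushout ((isPushout_facets S i hi).map F)
    have fac : F.map (SSet.Subcomplex.homOfLE (facets_mono (Set.subset_insert i S))) ≫
        F.map (facets.{w} (n + 1) (insert i S)).ι = F.map (facets.{w} (n + 1) S).ι := by
      rw [← F.map_comp, SSet.Subcomplex.homOfLE_ι]
    exact weakEquivalence_of_precomp_of_fac fac

variable {F} in
lemma IsReedyCofibrantConstant.weakEquivalence_horn (hF : IsReedyCofibrantConstant F) (n : ℕ)
    (i : Fin (n + 2)) : WeakEquivalence (F.map (SSet.horn.{w} (n + 1) i).ι) :=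
  facets_compl_singleton.{w} (n + 1) i ▸ hF.weakEquivalence_facets (n + 1) {i}ᶜ
    ⟨i.succAbove 0, Fin.succAbove_ne i 0⟩
    (ne_of_mem_of_not_mem' (Set.mem_univ i) (Set.notMem_compl_iff.2 (Set.mem_singleton i))).symm

end

section

variable [HasPushouts D] {F G : SSet.{w} ⥤ D} (τ : F ⟶ G)

/-- The relative latching map `F(L) ∪_{F(K)} G(K) ⟶ G(L)` of a natural transformation `F ⟶ G`
at a morphism `K ⟶ L`. -/
def relativeLatchingMap {K L : SSet.{w}} (i : K ⟶ L) :
    pushout (F.map i) (τ.app K) ⟶ G.obj L :=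
  pushout.desc (τ.app L) (G.map i) (τ.naturality i)

/-- The map between the sources of the relative latching maps of `f` and of `l`
for a commutative square from `f` to `l`. -/
def relativeLatchingSourceMap {K L K' L' : SSet.{w}} {i : K ⟶ L} {i' : K' ⟶ L'} (a : K ⟶ K')
    (b : L ⟶ L') (w : i ≫ b = a ≫ i') :
    pushout (F.map i) (τ.app K) ⟶ pushout (F.map i') (τ.app K') :=
  pushout.map _ _ _ _ (F.map b) (G.map a) (F.map a)
    (by rw [← F.map_comp, ← F.map_comp, w]) (by simp)

lemma inl_relativeLatchingMap {K L : SSet.{w}} (i : K ⟶ L) :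
    pushout.inl (F.map i) (τ.app K) ≫ relativeLatchingMap τ i = τ.app L :=
  pushout.inl_desc _ _ _

lemma inl_relativeLatchingMap_assoc {K L : SSet.{w}} (i : K ⟶ L) {Z : D} (g : G.obj L ⟶ Z) :
    pushout.inl (F.map i) (τ.app K) ≫ relativeLatchingMap τ i ≫ g = τ.app L ≫ g := by
  rw [← Category.assoc, inl_relativeLatchingMap]

lemma inr_relativeLatchingMap {K L : SSet.{w}} (i : K ⟶ L) :
    pushout.inr (F.map i) (τ.app K) ≫ relativeLatchingMap τ i = G.map i :=
  pushout.inr_desc _ _ _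

lemma inr_relativeLatchingMap_assoc {K L : SSet.{w}} (i : K ⟶ L) {Z : D} (g : G.obj L ⟶ Z) :
    pushout.inr (F.map i) (τ.app K) ≫ relativeLatchingMap τ i ≫ g = G.map i ≫ g := by
  rw [← Category.assoc, inr_relativeLatchingMap]

section

variable {K L K' L' : SSet.{w}} {i : K ⟶ L} {i' : K' ⟶ L'} (a : K ⟶ K') (b : L ⟶ L')
  (w : i ≫ b = a ≫ i')

lemma inl_relativeLatchingSourceMap :
    pushout.inl (F.map i) (τ.app K) ≫ relativeLatchingSourceMap τ a b w =
      F.map b ≫ pushout.inl (F.map i') (τ.app K') :=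
  pushout.inl_desc _ _ _

lemma inl_relativeLatchingSourceMap_assoc {Z : D} (g : pushout (F.map i') (τ.app K') ⟶ Z) :
    pushout.inl (F.map i) (τ.app K) ≫ relativeLatchingSourceMap τ a b w ≫ g =
      F.map b ≫ pushout.inl (F.map i') (τ.app K') ≫ g := by
  rw [← Category.assoc, inl_relativeLatchingSourceMap, Category.assoc]

lemma inr_relativeLatchingSourceMap :
    pushout.inr (F.map i) (τ.app K) ≫ relativeLatchingSourceMap τ a b w =
      G.map a ≫ pushout.inr (F.map i') (τ.app K') :=
  pushout.inr_desc _ _ _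

lemma inr_relativeLatchingSourceMap_assoc {Z : D} (g : pushout (F.map i') (τ.app K') ⟶ Z) :
    pushout.inr (F.map i) (τ.app K) ≫ relativeLatchingSourceMap τ a b w ≫ g =
      G.map a ≫ pushout.inr (F.map i') (τ.app K') ≫ g := by
  rw [← Category.assoc, inr_relativeLatchingSourceMap, Category.assoc]

lemma relativeLatchingSourceMap_comp :
    relativeLatchingSourceMap τ a b w ≫ relativeLatchingMap τ i' =
      relativeLatchingMap τ i ≫ G.map b := by
  apply pushout.hom_ext
  · rw [inl_relativeLatchingSourceMap_assoc, inl_relativeLatchingMap,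
      inl_relativeLatchingMap_assoc, τ.naturality]
  · rw [inr_relativeLatchingSourceMap_assoc, inr_relativeLatchingMap,
      inr_relativeLatchingMap_assoc, ← G.map_comp, ← G.map_comp, w]

end

lemma map_comp_inr_relativeLatchingMap {K L M : SSet.{w}} (j : M ⟶ K) (i : K ⟶ L) :
    (G.map j ≫ pushout.inr (F.map i) (τ.app K)) ≫ relativeLatchingMap τ i = G.map (j ≫ i) := by
  rw [Category.assoc, inr_relativeLatchingMap, G.map_comp]

lemma relativeLatchingSourceMap_id_comp {K K' L : SSet.{w}} (k : K ⟶ K') (l : K' ⟶ L) :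
    relativeLatchingSourceMap τ k (𝟙 L) (Category.comp_id _) ≫ relativeLatchingMap τ l =
      relativeLatchingMap τ (k ≫ l) := by
  rw [relativeLatchingSourceMap_comp, G.map_id, Category.comp_id]

lemma relativeLatchingMap_comp_inr {K₁ K₂ K₃ K₄ L : SSet.{w}} {f : K₁ ⟶ K₂} {g : K₁ ⟶ K₃}
    {h : K₂ ⟶ K₄} {k : K₃ ⟶ K₄} (w : f ≫ h = g ≫ k) (l : K₄ ⟶ L) :
    relativeLatchingMap τ f ≫ G.map h ≫ pushout.inr (F.map l) (τ.app K₄) =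
      relativeLatchingSourceMap τ (i' := k ≫ l) g (h ≫ l) (by simp only [reassoc_of% w]) ≫
        relativeLatchingSourceMap τ k (𝟙 L) (Category.comp_id _) := by
  apply pushout.hom_ext
  · rw [inl_relativeLatchingMap_assoc, inl_relativeLatchingSourceMap_assoc,
      inl_relativeLatchingSourceMap, F.map_id, Category.id_comp, F.map_comp, Category.assoc,
      pushout.condition, τ.naturality_assoc]
  · rw [inr_relativeLatchingMap_assoc, inr_relativeLatchingSourceMap_assoc,
      inr_relativeLatchingSourceMap, ← G.map_comp_assoc, ← G.map_comp_assoc, w]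

variable [F.IsLeftAdjoint] [G.IsLeftAdjoint]

lemma isPushout_relativeLatchingMap {K₁ K₂ K₃ K₄ L : SSet.{w}} {f : K₁ ⟶ K₂} {g : K₁ ⟶ K₃}
    {h : K₂ ⟶ K₄} {k : K₃ ⟶ K₄} (sq : IsPushout f g h k) (l : K₄ ⟶ L) :
    IsPushout (relativeLatchingMap τ f)
      (relativeLatchingSourceMap τ (i' := k ≫ l) g (h ≫ l) (by rw [sq.w_assoc]))
      (G.map h ≫ pushout.inr (F.map l) (τ.app K₄))
      (relativeLatchingSourceMap τ k (𝟙 L) (Category.comp_id _)) := by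
  have sqF := sq.map F
  have sqG := sq.map G
  refine ⟨⟨relativeLatchingMap_comp_inr τ sq.w l⟩,
    ⟨PushoutCocone.IsColimit.mk _ (fun s ↦ ?_) ?_ ?_ ?_⟩⟩
  · have w₁ : G.map f ≫ s.inl = G.map g ≫ pushout.inr (F.map (k ≫ l)) (τ.app K₃) ≫ s.inr := by
      have := pushout.inr (F.map f) (τ.app K₁) ≫= s.condition
      rwa [inr_relativeLatchingMap_assoc, inr_relativeLatchingSourceMap_assoc] at this
    refine pushout.desc (pushout.inl (F.map (k ≫ l)) (τ.app K₃) ≫ s.inr)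
      (sqG.desc s.inl (pushout.inr (F.map (k ≫ l)) (τ.app K₃) ≫ s.inr) w₁) ?_
    apply sqF.hom_ext
    · have := pushout.inl (F.map f) (τ.app K₁) ≫= s.condition
      rw [inl_relativeLatchingMap_assoc, inl_relativeLatchingSourceMap_assoc] at this
      rw [τ.naturality_assoc, sqG.inl_desc, this, ← F.map_comp_assoc]
    · rw [τ.naturality_assoc, sqG.inr_desc, ← F.map_comp_assoc, pushout.condition_assoc]
  · intro s
    rw [Category.assoc, pushout.inr_desc, sqG.inl_desc]
  · intro s
    apply pushout.hom_ext
    · rw [inl_relativeLatchingSourceMap_assoc, F.map_id, Category.id_comp, pushout.inl_desc]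
    · rw [inr_relativeLatchingSourceMap_assoc, pushout.inr_desc, sqG.inr_desc]
  · intro s m h₁ h₂
    apply pushout.hom_ext
    · rw [pushout.inl_desc, ← h₂, inl_relativeLatchingSourceMap_assoc, F.map_id,
        Category.id_comp]
    · rw [pushout.inr_desc]
      apply sqG.hom_ext
      · rw [sqG.inl_desc, ← h₁, Category.assoc]
      · rw [sqG.inr_desc, ← h₂, inr_relativeLatchingSourceMap_assoc]

end

section

variable [ModelCategory D] {F G : SSet.{w} ⥤ D} (τ : F ⟶ G)

lemma cofibration_relativeLatchingMap_facets [F.IsLeftAdjoint] [G.IsLeftAdjoint]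
    (hτ : ∀ n : ℕ, Cofibration (relativeLatchingMap τ (SSet.boundary.{w} n).ι)) (n : ℕ)
    (S : Set (Fin (n + 1))) :
    Cofibration (relativeLatchingMap τ (facets.{w} n S).ι) := by
  induction n, S using facets_induction with
  | empty =>
    rw [facets_empty, ← SSet.boundary_zero]
    exact hτ 0
  | univ n =>
    rw [facets_univ]
    exact hτ n
  | of_insert n S i hi _ _ =>
    have := cofibration_of_isPushout (isPushout_relativeLatchingMap τ (isPushout_facets S i hi)
      (facets.{w} (n + 1) (insert i S)).ι)
    rw [← SSet.Subcomplex.homOfLE_ι (facets_mono (Set.subset_insert i S)),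
      ← relativeLatchingSourceMap_id_comp]
    infer_instance

lemma weakEquivalence_relativeLatchingMap {K L : SSet.{w}} (i : K ⟶ L)
    [Cofibration (F.map i)] [WeakEquivalence (F.map i)] [WeakEquivalence (G.map i)] :
    WeakEquivalence (relativeLatchingMap τ i) := by
  have := weakEquivalence_of_isPushout (IsPushout.of_hasPushout (F.map i) (τ.app K))
  have e : pushout.inr (F.map i) (τ.app K) ≫ relativeLatchingMap τ i = G.map i :=
    pushout.inr_desc _ _ _
  exact weakEquivalence_of_precomp_of_fac e

lemma weakEquivalence_relativeLatchingMap_horn (hF : IsReedyCofibrantConstant F)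
    (hG : IsReedyCofibrantConstant G) (n : ℕ) (i : Fin (n + 2)) :
    WeakEquivalence (relativeLatchingMap τ (SSet.horn.{w} (n + 1) i).ι) := by
  have := hF.isLeftAdjoint
  have := cofibration_map_horn F hF.cofibration (n + 1) i
  have := hF.weakEquivalence_horn n i
  have := hG.weakEquivalence_horn n i
  exact weakEquivalence_relativeLatchingMap τ _

lemma cofibration_relativeLatchingMap_horn [F.IsLeftAdjoint] [G.IsLeftAdjoint]
    (hτ : ∀ n : ℕ, Cofibration (relativeLatchingMap τ (SSet.boundary.{w} n).ι)) (n : ℕ)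
    (i : Fin (n + 1)) : Cofibration (relativeLatchingMap τ (SSet.horn.{w} n i).ι) :=
  facets_compl_singleton.{w} n i ▸ cofibration_relativeLatchingMap_facets τ hτ n {i}ᶜ

lemma weakEquivalence_relativeLatchingMap_boundary (hF : IsReedyCofibrantConstant F)
    (hG : IsReedyCofibrantConstant G)
    (hτ : ∀ n : ℕ, Cofibration (relativeLatchingMap τ (SSet.boundary.{w} n).ι))
    (hτ' : ∀ n : ℕ, WeakEquivalence (τ.app Δ[n])) (n : ℕ) :
    WeakEquivalence (relativeLatchingMap τ (SSet.boundary.{w} n).ι) := by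
  have := hF.isLeftAdjoint
  have := hG.isLeftAdjoint
  induction n with
  | zero =>
    have h : IsInitial (∂Δ[0] : SSet.{w}) := by
      rw [SSet.boundary_zero]
      exact SSet.Subcomplex.isInitialBot
    have : IsIso (τ.app (∂Δ[0] : SSet.{w})) :=
      isIso_of_isInitial (h.isInitialObj F) (h.isInitialObj G) _
    have e : pushout.inl (F.map (SSet.boundary.{w} 0).ι) (τ.app _) ≫
        relativeLatchingMap τ (SSet.boundary.{w} 0).ι = τ.app Δ[0] :=
      pushout.inl_desc _ _ _
    have := hτ' 0
    exact weakEquivalence_of_precomp_of_fac e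
  | succ n hn =>
    have := hτ n
    have := weakEquivalence_of_isPushout (isPushout_relativeLatchingMap τ
      (isPushout_boundary_horn 0) (SSet.boundary.{w} (n + 1)).ι)
    have : WeakEquivalence (relativeLatchingMap τ
        (SSet.Subcomplex.homOfLE (horn_le_boundary 0) ≫ (SSet.boundary.{w} (n + 1)).ι)) :=
      weakEquivalence_relativeLatchingMap_horn τ hF hG n 0
    exact weakEquivalence_of_precomp_of_fac (relativeLatchingSourceMap_id_comp τ
      (SSet.Subcomplex.homOfLE (horn_le_boundary 0)) (SSet.boundary.{w} (n + 1)).ι)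

end

end Reedy

/-! ### Exchange of lifting properties -/

section Exchange

section

variable {C : Type*} [Category C] {a b l t : C}

/-- The lifting property of a commutative square `i ≫ u = g ≫ j` against a commutative square
`k ≫ h = d ≫ p`: morphisms `l ⟶ T`, `t ⟶ H` and `b ⟶ E` which are compatible over the rest of
the squares come from a morphism `t ⟶ T`. -/
def HasSquareLiftingProperty (i : a ⟶ b) (g : a ⟶ l) (u : b ⟶ t) (j : l ⟶ t) {T H E B : C}
    (k : T ⟶ H) (d : T ⟶ E) (h : H ⟶ B) (p : E ⟶ B) : Prop :=
  ∀ (x : l ⟶ T) (y : t ⟶ H) (z : b ⟶ E), x ≫ k = j ≫ y → i ≫ z = g ≫ x ≫ d → z ≫ p = u ≫ y ≫ h →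
    ∃ ε : t ⟶ T, j ≫ ε = x ∧ ε ≫ k = y ∧ u ≫ ε ≫ d = z

variable {c : C} {i : a ⟶ b} {g : a ⟶ l} {inl : b ⟶ c} {inr : l ⟶ c} (po : IsPushout i g inl inr)
  (i' : c ⟶ t) {T P H E B : C} {p : E ⟶ B} {h : H ⟶ B} {fst : P ⟶ H} {snd : P ⟶ E}
  (pb : IsPullback fst snd h p) (p' : T ⟶ P)

include po pb

lemma hasSquareLiftingProperty_of_pushout_of_pullback [HasLiftingProperty i' p]
    [HasLiftingProperty (inr ≫ i') p'] :
    HasSquareLiftingProperty i g (inl ≫ i') (inr ≫ i') (p' ≫ fst) (p' ≫ snd) h p := by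
  intro x y z hxy hxz hyz
  have sqE : CommSq (po.desc z (x ≫ p' ≫ snd) hxz) i' p (y ≫ h) := ⟨by
    apply po.hom_ext
    · simpa only [po.inl_desc_assoc, Category.assoc] using hyz
    · simpa only [po.inr_desc_assoc, Category.assoc, pb.w] using hxy =≫ h⟩
  have sqT : CommSq x (inr ≫ i') p' (pb.lift y sqE.lift sqE.fac_right.symm) := ⟨by
    apply pb.hom_ext
    · simpa only [Category.assoc, pb.lift_fst] using hxy
    · simp only [Category.assoc, pb.lift_snd, sqE.fac_left, po.inr_desc]⟩
  refine ⟨sqT.lift, sqT.fac_left, ?_, ?_⟩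
  · rw [sqT.fac_right_assoc, pb.lift_fst]
  · rw [sqT.fac_right_assoc, pb.lift_snd, Category.assoc, sqE.fac_left, po.inl_desc]

lemma hasSquareLiftingProperty_of_pullback_of_pushout [HasLiftingProperty i p']
    [HasLiftingProperty i' (p' ≫ fst)] :
    HasSquareLiftingProperty i g (inl ≫ i') (inr ≫ i') (p' ≫ fst) (p' ≫ snd) h p := by
  intro x y z hxy hxz hyz
  have sqT : CommSq (g ≫ x) i p' (pb.lift (inl ≫ i' ≫ y) z (by simpa using hyz.symm)) := ⟨by
    apply pb.hom_ext
    · simp only [Category.assoc, pb.lift_fst, hxy, po.w_assoc]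
    · simp only [Category.assoc, pb.lift_snd, hxz]⟩
  have sqH : CommSq (po.desc sqT.lift x sqT.fac_left) i' (p' ≫ fst) y := ⟨by
    apply po.hom_ext
    · rw [po.inl_desc_assoc, sqT.fac_right_assoc, pb.lift_fst]
    · simpa only [po.inr_desc_assoc, Category.assoc] using hxy⟩
  refine ⟨sqH.lift, ?_, sqH.fac_right, ?_⟩
  · rw [Category.assoc, sqH.fac_left, po.inr_desc]
  · rw [Category.assoc, sqH.fac_left_assoc, po.inl_desc_assoc, sqT.fac_right_assoc, pb.lift_snd]

lemma hasLiftingProperty_pullback_of_hasSquareLiftingProperty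
    (hsq : HasSquareLiftingProperty i g (inl ≫ i') (inr ≫ i') (p' ≫ fst) (p' ≫ snd) h p)
    [HasLiftingProperty i (p' ≫ fst)] (hext : ∀ y : b ⟶ T, ∃ ε : t ⟶ T, (inl ≫ i') ≫ ε = y) :
    HasLiftingProperty i p' where
  sq_hasLift {f x} sq := by
    have sqH : CommSq f i (p' ≫ fst) (x ≫ fst) := ⟨by rw [sq.w_assoc]⟩
    obtain ⟨ε₀, hε₀⟩ := hext sqH.lift
    rw [Category.assoc] at hε₀
    obtain ⟨ε, hl, hH, hE⟩ := hsq (inr ≫ i' ≫ ε₀) (ε₀ ≫ p' ≫ fst) (x ≫ snd)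
      (by simp only [Category.assoc])
      (by rw [← sq.w_assoc, Category.assoc, Category.assoc, ← po.w_assoc, reassoc_of% hε₀,
        sqH.fac_left_assoc])
      (by rw [Category.assoc, ← pb.w, Category.assoc, Category.assoc, reassoc_of% hε₀,
        ← reassoc_of% sqH.fac_right, Category.assoc])
    refine ⟨⟨⟨inl ≫ i' ≫ ε, ?_, ?_⟩⟩⟩
    · rw [Category.assoc] at hl
      rw [po.w_assoc, hl, ← po.w_assoc, hε₀, sqH.fac_left]
    · apply pb.hom_ext
      · rw [Category.assoc, Category.assoc, Category.assoc, hH, reassoc_of% hε₀,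
          sqH.fac_right]
      · simpa only [Category.assoc] using hE

lemma hasLiftingProperty_pushout_of_hasSquareLiftingProperty
    (hsq : HasSquareLiftingProperty i g (inl ≫ i') (inr ≫ i') (p' ≫ fst) (p' ≫ snd) h p)
    [HasLiftingProperty (inr ≫ i') p] (hlift : ∀ e : t ⟶ E, ∃ ε : t ⟶ T, ε ≫ p' ≫ snd = e) :
    HasLiftingProperty i' p where
  sq_hasLift {f z} sq := by
    have sqE : CommSq (inr ≫ f) (inr ≫ i') p z := ⟨by rw [Category.assoc, Category.assoc, sq.w]⟩
    obtain ⟨ε₀, hε₀⟩ := hlift sqE.lift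
    have hl₀ : inr ≫ i' ≫ ε₀ ≫ p' ≫ snd = inr ≫ f := by
      rw [hε₀, ← Category.assoc, sqE.fac_left]
    have hz : ε₀ ≫ p' ≫ fst ≫ h = z := by
      rw [pb.w, ← sqE.fac_right, ← hε₀, Category.assoc, Category.assoc]
    obtain ⟨ε, hl, hH, hE⟩ := hsq (inr ≫ i' ≫ ε₀) (ε₀ ≫ p' ≫ fst) (inl ≫ f)
      (by simp only [Category.assoc])
      (by simp only [Category.assoc, hl₀, po.w_assoc])
      (by simp only [Category.assoc, hz, sq.w])
    refine ⟨⟨⟨ε ≫ p' ≫ snd, ?_, ?_⟩⟩⟩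
    · apply po.hom_ext
      · simpa only [Category.assoc] using hE
      · rw [Category.assoc] at hl
        rw [reassoc_of% hl, hl₀]
    · have := hH =≫ h
      simp only [Category.assoc] at this
      rw [Category.assoc, Category.assoc, ← pb.w, this, hz]

lemma hasLiftingProperty_pushout_iff_pullback {u : b ⟶ t} {j : l ⟶ t} (hu : inl ≫ i' = u)
    (hj : inr ≫ i' = j) {k : T ⟶ H} {d : T ⟶ E} (hk : p' ≫ fst = k) (hd : p' ≫ snd = d)
    [HasLiftingProperty j p] [HasLiftingProperty j p'] (hik : HasLiftingProperty i k)
    (hik' : HasLiftingProperty i' k) (hext : ∀ y : b ⟶ T, ∃ ε : t ⟶ T, u ≫ ε = y)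
    (hlift : ∀ e : t ⟶ E, ∃ ε : t ⟶ T, ε ≫ d = e) :
    HasLiftingProperty i' p ↔ HasLiftingProperty i p' := by
  subst hu hj hk hd
  exact ⟨fun _ ↦ hasLiftingProperty_pullback_of_hasSquareLiftingProperty po i' pb p'
      (hasSquareLiftingProperty_of_pushout_of_pullback po i' pb p') hext,
    fun _ ↦ hasLiftingProperty_pushout_of_hasSquareLiftingProperty po i' pb p'
      (hasSquareLiftingProperty_of_pullback_of_pushout po i' pb p') hlift⟩

end

variable {C : Type u} [Category.{w} C] [ModelCategory C]

lemma IsReedyCofibrantConstant.cofibration_δ {F : SSet.{w} ⥤ C}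
    (hF : IsReedyCofibrantConstant F) {n : ℕ} (i : Fin (n + 2)) :
    Cofibration (F.map (SSet.stdSimplex.map (SimplexCategory.δ i))) := by
  have := hF.isLeftAdjoint
  have := isIso_facetMap_singleton.{w} i
  have := cofibration_map_facets F hF.cofibration (n + 1) {i}
  have fac : F.map (SSet.stdSimplex.map (SimplexCategory.δ i)) =
      F.map (facetMap.{w} (Set.mem_singleton i)) ≫ F.map (facets.{w} (n + 1) {i}).ι := by
    rw [← F.map_comp]
    rfl
  rw [fac]
  infer_instance

lemma IsReedyCofibrantConstant.isCofibrant {F : SSet.{w} ⥤ C}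
    (hF : IsReedyCofibrantConstant F) (n : ℕ) :
    IsCofibrant (F.obj Δ[n]) := by
  have := hF.isLeftAdjoint
  have h := cofibration_map_facets F hF.cofibration n ∅
  rw [facets_empty] at h
  rwa [isCofibrant_iff_of_isInitial (F.map (⊥ : (Δ[n] : SSet.{w}).Subcomplex).ι)
    (SSet.Subcomplex.isInitialBot.isInitialObj F)]

lemma IsReedyCofibrantConstant.exists_extension_δ {F : SSet.{w} ⥤ C}
    (hF : IsReedyCofibrantConstant F) {n : ℕ} (i : Fin (n + 2)) {X : C} [IsFibrant X]
    (y : F.obj Δ[n] ⟶ X) :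
    ∃ ε : F.obj Δ[n + 1] ⟶ X, F.map (SSet.stdSimplex.map (SimplexCategory.δ i)) ≫ ε = y := by
  have := hF.cofibration_δ i
  have := hF.weakEquivalence (SimplexCategory.δ i)
  have sq : CommSq y (F.map (SSet.stdSimplex.map (SimplexCategory.δ i)))
    (terminal.from X) (terminal.from _) := ⟨Subsingleton.elim _ _⟩
  exact ⟨sq.lift, sq.fac_left⟩

lemma IsReedyCofibrantConstant.exists_lift_δ {G : SSet.{w} ⥤ Cᵒᵖ}
    (hG : IsReedyCofibrantConstant G) {n : ℕ} (i : Fin (n + 2)) {X : C} [IsCofibrant X]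
    (z : X ⟶ (G.obj Δ[n]).unop) :
    ∃ ε : X ⟶ (G.obj Δ[n + 1]).unop,
      ε ≫ (G.map (SSet.stdSimplex.map (SimplexCategory.δ i))).unop = z := by
  have := hG.cofibration_δ i
  have := hG.weakEquivalence (SimplexCategory.δ i)
  have sq : CommSq (initial.to _) (initial.to X)
    (G.map (SSet.stdSimplex.map (SimplexCategory.δ i))).unop z := ⟨Subsingleton.elim _ _⟩
  exact ⟨sq.lift, sq.fac_right⟩

/- Up to weak equivalence, `∂Δ[m + 1]` is obtained from a point by attaching `Δ[m]` along `∂Δ[m]`,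
so that raising the latching degree of `F` amounts to raising the matching degree of `τ`. -/
lemma hasLiftingProperty_latching_succ_iff {F : SSet.{w} ⥤ C} {G G' : SSet.{w} ⥤ Cᵒᵖ}
    (τ : G ⟶ G') (hF : IsReedyCofibrantConstant F) (hG : IsReedyCofibrantConstant G)
    (hG' : IsReedyCofibrantConstant G')
    (hτ : ∀ n : ℕ, Cofibration (relativeLatchingMap τ (SSet.boundary.{w} n).ι))
    (hC : ∀ X : C, IsFibrant X) (m n : ℕ) :
    HasLiftingProperty (F.map (SSet.boundary.{w} (m + 1)).ι)
      (relativeLatchingMap τ (SSet.boundary.{w} n).ι).unop ↔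
    HasLiftingProperty (F.map (SSet.boundary.{w} m).ι)
      (relativeLatchingMap τ (SSet.boundary.{w} (n + 1)).ι).unop := by
  have := hF.isLeftAdjoint
  have := hG.isLeftAdjoint
  have := hG'.isLeftAdjoint
  have := hF.cofibration
  have := cofibration_map_horn F hF.cofibration (m + 1) 0
  have := hF.weakEquivalence_horn m 0
  have := cofibration_relativeLatchingMap_horn τ hτ (n + 1) 0
  have := weakEquivalence_relativeLatchingMap_horn τ hG hG' n 0
  have po := (isPushout_boundary_horn.{w} (n := m) 0).map F
  have pb := (isPushout_relativeLatchingMap τ (isPushout_boundary_horn.{w} (n := n) 0)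
    (SSet.boundary.{w} (n + 1)).ι).unop
  have lifting (k : ℕ) : HasLiftingProperty (F.map (SSet.boundary.{w} k).ι)
    (relativeLatchingMap τ (SSet.horn.{w} (n + 1) 0).ι).unop := inferInstance
  have := hC (G'.obj Δ[n + 1]).unop
  have := hF.isCofibrant (m + 1)
  exact hasLiftingProperty_pushout_iff_pullback po (F.map (SSet.boundary.{w} (m + 1)).ι) pb
    (relativeLatchingMap τ (SSet.boundary.{w} (n + 1)).ι).unop
    (j := F.map (SSet.horn.{w} (m + 1) 0).ι)
    (k := (relativeLatchingMap τ (SSet.horn.{w} (n + 1) 0).ι).unop)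
    (F.map_comp _ _).symm (F.map_comp _ _).symm
    (congrArg Quiver.Hom.unop (relativeLatchingSourceMap_id_comp τ _ _))
    (congrArg Quiver.Hom.unop (map_comp_inr_relativeLatchingMap τ _ _))
    (lifting m) (lifting (m + 1)) (hF.exists_extension_δ 0) (hG'.exists_lift_δ 0)

lemma hasLiftingProperty_latching_iff {F : SSet.{w} ⥤ C} {G G' : SSet.{w} ⥤ Cᵒᵖ}
    (τ : G ⟶ G') (hF : IsReedyCofibrantConstant F) (hG : IsReedyCofibrantConstant G)
    (hG' : IsReedyCofibrantConstant G')
    (hτ : ∀ n : ℕ, Cofibration (relativeLatchingMap τ (SSet.boundary.{w} n).ι))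
    (hC : ∀ X : C, IsFibrant X) (n : ℕ) :
    HasLiftingProperty (F.map (SSet.boundary.{w} n).ι)
      (relativeLatchingMap τ (SSet.boundary.{w} 0).ι).unop ↔
    HasLiftingProperty (F.map (SSet.boundary.{w} 0).ι)
      (relativeLatchingMap τ (SSet.boundary.{w} n).ι).unop := by
  suffices ∀ m k : ℕ, HasLiftingProperty (F.map (SSet.boundary.{w} (m + k)).ι)
      (relativeLatchingMap τ (SSet.boundary.{w} 0).ι).unop ↔
      HasLiftingProperty (F.map (SSet.boundary.{w} m).ι)
        (relativeLatchingMap τ (SSet.boundary.{w} k).ι).unop by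
    have := this 0 n
    rwa [zero_add] at this
  intro m k
  induction k generalizing m with
  | zero => rfl
  | succ k hk =>
    rw [← hasLiftingProperty_latching_succ_iff τ hF hG hG' hτ hC m k, ← hk (m + 1),
      show m + (k + 1) = m + 1 + k by lia]

end Exchange

/-! ### Copowers and cotensors by simplicial sets -/

section Copower

variable {C : Type u} [Category.{w} C]

lemma exists_family_lift {α β : Type*} {k : α → β} (hk : Function.Injective k) {a b X Y : C}
    {j : a ⟶ b} {f : X ⟶ Y} [HasLiftingProperty j f] (u : β → (a ⟶ X)) (v : β → (b ⟶ Y))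
    (w : ∀ x, u x ≫ f = j ≫ v x) (s : α → (b ⟶ X)) (hu : ∀ y, j ≫ s y = u (k y))
    (hv : ∀ y, s y ≫ f = v (k y)) :
    ∃ φ : β → (b ⟶ X), (∀ x, j ≫ φ x = u x) ∧ (∀ x, φ x ≫ f = v x) ∧ ∀ y, φ (k y) = s y := by
  have lift (x : β) : ∃ φ : b ⟶ X, j ≫ φ = u x ∧ φ ≫ f = v x ∧ ∀ y, k y = x → φ = s y := by
    by_cases hx : ∃ y, k y = x
    · obtain ⟨y, rfl⟩ := hx
      exact ⟨s y, hu y, hv y, fun z hz ↦ by rw [hk hz]⟩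
    · have sq : CommSq (u x) j f (v x) := ⟨w x⟩
      exact ⟨sq.lift, sq.fac_left, sq.fac_right, fun y hy ↦ (hx ⟨y, hy⟩).elim⟩
  choose φ hφu hφv hφ using lift
  exact ⟨φ, hφu, hφv, fun y ↦ hφ _ y rfl⟩

section

variable [HasColimits C]

/-- The copower `L ⊙ b` of an object `b` by a simplicial set `L`. -/
def copower : SSet.{w} ⥤ C ⥤ SimplexCategoryᵒᵖ ⥤ C where
  obj L :=
    { obj b := L ⋙ sigmaConst.obj b
      map j := Functor.whiskerLeft L (sigmaConst.map j) }
  map i :=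
    { app b := Functor.whiskerRight i (sigmaConst.obj b)
      naturality b b' j := by
        ext m
        apply Sigma.hom_ext
        intro x
        simp }

/-- The inclusion of the summand of `(L ⊙ b)_m` which corresponds to an `m`-simplex of `L`. -/
def copowerι {L : SSet.{w}} (b : C) {m : SimplexCategoryᵒᵖ} (x : L.obj m) :
    b ⟶ ((copower.obj L).obj b).obj m :=
  Sigma.ι (fun _ : L.obj m ↦ b) x

lemma copowerι_map {L : SSet.{w}} (b : C) {m m' : SimplexCategoryᵒᵖ} (x : L.obj m) (g : m ⟶ m') :
    copowerι b x ≫ ((copower.obj L).obj b).map g = copowerι b (L.map g x) := by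
  refine (Sigma.ι_comp_map' _ _ _).trans ?_
  exact Category.id_comp _

lemma copowerι_obj_map_app {L : SSet.{w}} {b b' : C} (j : b ⟶ b') {m : SimplexCategoryᵒᵖ}
    (x : L.obj m) : copowerι b x ≫ ((copower.obj L).map j).app m = j ≫ copowerι b' x :=
  Sigma.ι_map (fun _ : L.obj m ↦ j) x

lemma copowerι_map_app_app {L L' : SSet.{w}} (i : L ⟶ L') (b : C) {m : SimplexCategoryᵒᵖ}
    (x : L.obj m) : copowerι b x ≫ ((copower.map i).app b).app m = copowerι b (i.app m x) := by
  refine (Sigma.ι_comp_map' _ _ _).trans ?_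
  exact Category.id_comp _

lemma copower_hom_ext {L : SSet.{w}} {b X : C} {m : SimplexCategoryᵒᵖ}
    {f g : ((copower.obj L).obj b).obj m ⟶ X}
    (h : ∀ x : L.obj m, copowerι b x ≫ f = copowerι b x ≫ g) : f = g :=
  Sigma.hom_ext _ _ h

/-- Constructor for morphisms from the levels of `L ⊙ b`. -/
def copowerDesc {L : SSet.{w}} {b X : C} {m : SimplexCategoryᵒᵖ} (f : L.obj m → (b ⟶ X)) :
    ((copower.obj L).obj b).obj m ⟶ X :=
  Sigma.desc f

lemma copowerι_copowerDesc {L : SSet.{w}} {b X : C} {m : SimplexCategoryᵒᵖ}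
    (f : L.obj m → (b ⟶ X)) (x : L.obj m) : copowerι b x ≫ copowerDesc f = f x :=
  Sigma.ι_desc _ _

lemma hasLiftingProperty_copower_iff {K L : SSet.{w}} (i : K ⟶ L) (X : C)
    {Y Z : SimplexCategoryᵒᵖ ⥤ C} (p : Y ⟶ Z) :
    HasLiftingProperty ((copower.map i).app X) p ↔ HasLiftingProperty i (homComplexMap X p) :=
  ((sigmaConstAdj X).whiskerRight SimplexCategoryᵒᵖ).hasLiftingProperty_iff i p

/-- The pushout-corner map `(K ⊙ b) ∪ (L ⊙ a) ⟶ L ⊙ b` of `i : K ⟶ L` and `j : a ⟶ b`. -/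
def copowerCorner {K L : SSet.{w}} (i : K ⟶ L) {a b : C} (j : a ⟶ b) :=
  (Functor.PushoutObjObj.ofHasPushout copower i j).ι

lemma hasLiftingProperty_copowerCorner_app {K L : SSet.{w}} (i : K ⟶ L) [Mono i] {a b : C}
    (j : a ⟶ b) (m : SimplexCategoryᵒᵖ) {X Y : C} (f : X ⟶ Y) [HasLiftingProperty j f] :
    HasLiftingProperty ((copowerCorner i j).app m) f where
  sq_hasLift {u v} sq := by
    let S := Functor.PushoutObjObj.ofHasPushout copower i j
    have po : IsPushout (((copower.map i).app a).app m) (((copower.obj K).map j).app m)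
      (S.inl.app m) (S.inr.app m) := S.isPushout.map ((evaluation _ _).obj m)
    have inl_corner : S.inl.app m ≫ (copowerCorner i j).app m = ((copower.obj L).map j).app m :=
      NatTrans.congr_app S.inl_ι m
    have inr_corner : S.inr.app m ≫ (copowerCorner i j).app m = ((copower.map i).app b).app m :=
      NatTrans.congr_app S.inr_ι m
    have injective : Function.Injective (i.app m) := by
      rw [← mono_iff_injective]
      infer_instance
    obtain ⟨φ, hφu, hφv, hφ⟩ := exists_family_lift injective (j := j) (f := f)
      (fun x ↦ copowerι a x ≫ S.inl.app m ≫ u) (fun x ↦ copowerι b x ≫ v)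
      (fun x ↦ by
        rw [Category.assoc, Category.assoc, sq.w, reassoc_of% inl_corner, ← Category.assoc,
          copowerι_obj_map_app, Category.assoc])
      (fun y ↦ copowerι b y ≫ S.inr.app m ≫ u)
      (fun y ↦ by
        rw [← Category.assoc, ← copowerι_obj_map_app, Category.assoc, ← po.w_assoc,
          ← Category.assoc, copowerι_map_app_app])
      (fun y ↦ by
        rw [Category.assoc, Category.assoc, sq.w, reassoc_of% inr_corner, ← Category.assoc,
          copowerι_map_app_app])
    refine ⟨⟨⟨copowerDesc φ, po.hom_ext (copower_hom_ext fun x ↦ ?_)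
      (copower_hom_ext fun y ↦ ?_), copower_hom_ext fun x ↦ ?_⟩⟩⟩
    · rw [reassoc_of% inl_corner, ← Category.assoc, copowerι_obj_map_app, Category.assoc,
        copowerι_copowerDesc, hφu]
    · rw [reassoc_of% inr_corner, ← Category.assoc, copowerι_map_app_app, copowerι_copowerDesc, hφ]
    · rw [← Category.assoc, copowerι_copowerDesc, hφv]

end

section

variable [HasLimits C]

/-- The cotensor `Y ^ L` of a simplicial object `Y` by a simplicial set `L`. -/
def cotensor : SSet.{w}ᵒᵖ ⥤ (SimplexCategoryᵒᵖ ⥤ C) ⥤ C where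
  obj L :=
    { obj Y := (tensorObj Y.rightOp L.unop).unop
      map p := (tensorTransApp (NatTrans.rightOp p) L.unop).unop
      map_id Y := congrArg Quiver.Hom.unop (tensorTransApp_id Y.rightOp L.unop)
      map_comp p q := congrArg Quiver.Hom.unop
        (tensorTransApp_comp (NatTrans.rightOp q) (NatTrans.rightOp p) L.unop) }
  map i :=
    { app Y := (tensorMap Y.rightOp i.unop).unop
      naturality Y Y' p := congrArg Quiver.Hom.unop
        (tensorMap_tensorTransApp (NatTrans.rightOp p) i.unop) }
  map_id L := by
    ext Y
    exact congrArg Quiver.Hom.unop ((tensorFunctor Y.rightOp).map_id L.unop)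
  map_comp i j := by
    ext Y
    exact congrArg Quiver.Hom.unop ((tensorFunctor Y.rightOp).map_comp j.unop i.unop)

/-- The projection `Y ^ L ⟶ Y_m` which corresponds to a simplex `Δ[m] ⟶ L`. -/
def cotensorπ (Y : SimplexCategoryᵒᵖ ⥤ C) {L : SSet.{w}} {m : SimplexCategoryᵒᵖ} (x : L.obj m) :
    (cotensor.obj (op L)).obj Y ⟶ Y.obj m :=
  (tensorι Y.rightOp (L := L) (m := m.unop) (SSet.yonedaEquiv.symm x)).unop

lemma cotensorπ_map (Y : SimplexCategoryᵒᵖ ⥤ C) {L : SSet.{w}} {m m' : SimplexCategoryᵒᵖ}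
    (x : L.obj m) (g : m ⟶ m') :
    cotensorπ Y x ≫ Y.map g = cotensorπ Y (L.map g x) := by
  refine congrArg Quiver.Hom.unop ((map_tensorι Y.rightOp g.unop _).trans ?_)
  exact congrArg (tensorι Y.rightOp) (map_comp_yonedaEquiv_symm g.unop x)

lemma cotensor_hom_ext {b : C} {Y : SimplexCategoryᵒᵖ ⥤ C} {L : SSet.{w}}
    {f g : b ⟶ (cotensor.obj (op L)).obj Y}
    (h : ∀ (m : SimplexCategoryᵒᵖ) (x : L.obj m), f ≫ cotensorπ Y x = g ≫ cotensorπ Y x) :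
    f = g := by
  refine Quiver.Hom.op_inj (tensorObj_hom_ext (A := Y.rightOp) fun m x ↦ ?_)
  have := h (op m) (SSet.yonedaEquiv x)
  rw [cotensorπ, Equiv.symm_apply_apply] at this
  exact congrArg Quiver.Hom.op this

lemma obj_map_cotensorπ {Y Y' : SimplexCategoryᵒᵖ ⥤ C} (p : Y ⟶ Y') {L : SSet.{w}}
    {m : SimplexCategoryᵒᵖ} (x : L.obj m) :
    (cotensor.obj (op L)).map p ≫ cotensorπ Y' x = cotensorπ Y x ≫ p.app m :=
  congrArg Quiver.Hom.unop (tensorι_tensorTransApp (NatTrans.rightOp p) _)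

lemma map_app_cotensorπ (Y : SimplexCategoryᵒᵖ ⥤ C) {L L' : SSet.{w}} (i : L ⟶ L')
    {m : SimplexCategoryᵒᵖ} (x : L.obj m) :
    (cotensor.map i.op).app Y ≫ cotensorπ Y x = cotensorπ Y (i.app m x) := by
  refine congrArg Quiver.Hom.unop ((tensorι_tensorMap Y.rightOp _ i).trans ?_)
  refine congrArg (tensorι Y.rightOp) (SSet.yonedaEquiv.injective ?_)
  rw [Equiv.apply_symm_apply]
  exact congrArg (i.app m) (SSet.yonedaEquiv.apply_symm_apply x)

end

variable [HasLimits C] [HasColimits C]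

/-- The map `L ⟶ C(b, Y_•)` attached to `L ⊙ b ⟶ Y`. -/
def copowerToSingular {L : SSet.{w}} {b : C} {Y : SimplexCategoryᵒᵖ ⥤ C}
    (f : (copower.obj L).obj b ⟶ Y) : L ⟶ (singular Y.rightOp).obj (op b) where
  app m := ↾fun x ↦ (copowerι b x ≫ f.app m).op
  naturality m m' g := by
    ext x
    refine congrArg Quiver.Hom.op ?_
    change copowerι b (L.map g x) ≫ f.app m' = (copowerι b x ≫ f.app m) ≫ Y.map g
    rw [Category.assoc, ← f.naturality, ← Category.assoc, copowerι_map]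

/-- Constructor for morphisms to `Y ^ L`. -/
def cotensorLift {L : SSet.{w}} {b : C} {Y : SimplexCategoryᵒᵖ ⥤ C}
    (f : (copower.obj L).obj b ⟶ Y) : b ⟶ (cotensor.obj (op L)).obj Y :=
  (tensorDesc Y.rightOp (copowerToSingular f)).unop

lemma cotensorLift_cotensorπ {L : SSet.{w}} {b : C} {Y : SimplexCategoryᵒᵖ ⥤ C}
    (f : (copower.obj L).obj b ⟶ Y) {m : SimplexCategoryᵒᵖ} (x : L.obj m) :
    cotensorLift f ≫ cotensorπ Y x = copowerι b x ≫ f.app m := by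
  refine (congrArg Quiver.Hom.unop (tensorι_tensorDesc Y.rightOp (copowerToSingular f)
    (SSet.yonedaEquiv.symm x))).trans ?_
  rw [Equiv.apply_symm_apply]
  rfl

/-- Morphisms `L ⊙ b ⟶ Y` correspond to morphisms `b ⟶ Y ^ L`. -/
def copowerHomEquiv (L : SSet.{w}) (b : C) (Y : SimplexCategoryᵒᵖ ⥤ C) :
    ((copower.obj L).obj b ⟶ Y) ≃ (b ⟶ (cotensor.obj (op L)).obj Y) where
  toFun f := cotensorLift f
  invFun g :=
    { app m := copowerDesc (fun x ↦ g ≫ cotensorπ Y x)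
      naturality m m' h := by
        apply copower_hom_ext
        intro x
        rw [← Category.assoc, copowerι_map, copowerι_copowerDesc, ← Category.assoc,
          copowerι_copowerDesc, Category.assoc, cotensorπ_map] }
  left_inv f := by
    ext m : 2
    apply copower_hom_ext
    intro x
    rw [copowerι_copowerDesc, cotensorLift_cotensorπ]
  right_inv g := by
    apply cotensor_hom_ext
    intro m x
    rw [cotensorLift_cotensorπ, copowerι_copowerDesc]

variable (C) in
/-- The copowers and the cotensors by simplicial sets form an adjunction of two variables. -/
def copowerAdj : (copower : SSet.{w} ⥤ C ⥤ _) ⊣₂ cotensor :=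
  ParametrizedAdjunction.mk' (fun L ↦ Adjunction.mkOfHomEquiv
    { homEquiv := copowerHomEquiv L
      homEquiv_naturality_left_symm {b b' Y} j g := by
        ext m : 2
        apply copower_hom_ext
        intro x
        refine (copowerι_copowerDesc _ _).trans ?_
        rw [NatTrans.comp_app, ← Category.assoc, copowerι_obj_map_app, Category.assoc,
          Category.assoc]
        exact congrArg (j ≫ ·) (copowerι_copowerDesc (fun x ↦ g ≫ cotensorπ Y x) x).symm
      homEquiv_naturality_right f p := by
        apply cotensor_hom_ext
        intro m x
        rw [Category.assoc, obj_map_cotensorπ, ← Category.assoc]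
        refine (cotensorLift_cotensorπ _ _).trans (Eq.trans ?_
          (congrArg (· ≫ p.app m) (cotensorLift_cotensorπ f x)).symm)
        rw [NatTrans.comp_app, Category.assoc] })
    (fun i b Y f ↦ by
      simp only [Adjunction.mkOfHomEquiv_homEquiv]
      apply cotensor_hom_ext
      intro m x
      refine (cotensorLift_cotensorπ _ _).trans ?_
      rw [Category.assoc, map_app_cotensorπ, NatTrans.comp_app, ← Category.assoc,
        copowerι_map_app_app]
      exact (cotensorLift_cotensorπ _ _).symm)

/-- The relative matching map `Y ^ L ⟶ Y ^ K ×_{Z ^ K} Z ^ L` of a morphism of simplicial objects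
`Y ⟶ Z` at a morphism `K ⟶ L`. -/
def relativeMatchingMap {Y Z : SimplexCategoryᵒᵖ ⥤ C} (p : Y ⟶ Z) {K L : SSet.{w}} (i : K ⟶ L) :=
  (relativeLatchingMap (tensorTrans (NatTrans.rightOp p)) i).unop

/-- The relative matching map as a pullback-corner map. -/
def pullbackObjObj {Y Z : SimplexCategoryᵒᵖ ⥤ C} (p : Y ⟶ Z) {K L : SSet.{w}} (i : K ⟶ L) :
    (cotensor (C := C)).PullbackObjObj i p where
  pt := (pushout ((tensorFunctor Z.rightOp).map i)
    ((tensorTrans (NatTrans.rightOp p)).app K)).unop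
  fst := (pushout.inr ((tensorFunctor Z.rightOp).map i)
    ((tensorTrans (NatTrans.rightOp p)).app K)).unop
  snd := (pushout.inl ((tensorFunctor Z.rightOp).map i)
    ((tensorTrans (NatTrans.rightOp p)).app K)).unop
  isPullback := (IsPushout.of_hasPushout ((tensorFunctor Z.rightOp).map i)
    ((tensorTrans (NatTrans.rightOp p)).app K)).unop
  π := relativeMatchingMap p i
  π_fst := congrArg Quiver.Hom.unop
    (inr_relativeLatchingMap (tensorTrans (NatTrans.rightOp p)) i)
  π_snd := congrArg Quiver.Hom.unop
    (inl_relativeLatchingMap (tensorTrans (NatTrans.rightOp p)) i)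

lemma hasLiftingProperty_copowerCorner_iff {K L : SSet.{w}} (i : K ⟶ L) {a b : C} (j : a ⟶ b)
    {Y Z : SimplexCategoryᵒᵖ ⥤ C} (p : Y ⟶ Z) :
    HasLiftingProperty (copowerCorner i j) p ↔ HasLiftingProperty j (relativeMatchingMap p i) :=
  (copowerAdj C).hasLiftingProperty_iff _ (pullbackObjObj p i)

lemma hasLiftingProperty_homComplexMap_iff {K L : SSet.{w}} (i : K ⟶ L) (X : C)
    {Y Z : SimplexCategoryᵒᵖ ⥤ C} (p : Y ⟶ Z) :
    HasLiftingProperty i (homComplexMap X p) ↔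
      HasLiftingProperty (initial.to X) (relativeMatchingMap p i) := by
  have h (L : SSet.{w}) : IsInitial ((copower.obj L).obj (⊥_ C)) := by
    have := ((copowerAdj C).adj L).leftAdjoint_preservesColimits
    exact initialIsInitial.isInitialObj (copower.obj L)
  have := isIso_of_isInitial (h K) (h L) ((copower.map i).app (⊥_ C))
  let sq : copower.PushoutObjObj i (initial.to X) :=
    { pt := (copower.obj K).obj X
      inl := (h L).to _
      inr := 𝟙 _
      isPushout := IsPushout.of_horiz_isIso ⟨(h K).hom_ext _ _⟩
      ι := (copower.map i).app X
      inl_ι := (h L).hom_ext _ _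
      inr_ι := Category.id_comp _ }
  rw [← hasLiftingProperty_copower_iff]
  exact (copowerAdj C).hasLiftingProperty_iff sq (pullbackObjObj p i)

end Copower

/-! ### The small object argument in locally presentable categories -/

section SmallObject

lemma hasSmallObjectArgument_of_isLocallyPresentable {D : Type*} [Category* D]
    [LocallySmall.{w} D] [IsLocallyPresentable.{w} D]
    (W : MorphismProperty D) [MorphismProperty.IsSmall.{w} W] :
    MorphismProperty.HasSmallObjectArgument.{w} W := by
  have : HasColimitsOfSize.{w, w} D := by
    obtain ⟨κ, _, _⟩ := IsLocallyPresentable.exists_cardinal.{w} D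
    infer_instance
  obtain ⟨ι, A, B, f, rfl⟩ := (MorphismProperty.isSmall_iff_eq_ofHoms.{w} W).1 inferInstance
  choose κ' hκ' _ using fun i ↦ (inferInstance : IsPresentable.{w} (A i)).exists_cardinal
  obtain ⟨κ, hκ, hκ'_lt⟩ := HasCardinalLT.exists_regular_cardinal_forall.{w} fun i ↦ (κ' i).out
  have : Fact κ.IsRegular := ⟨hκ⟩
  have : Nonempty κ.ord.ToType := by simpa using hκ.ne_zero
  let _ := WellFoundedLT.toOrderBot κ.ord.ToType
  refine ⟨κ, inferInstance, inferInstance, { preservesColimit := ?_ }⟩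
  rintro _ _ _ _ _ ⟨i⟩ _ _
  have hκ'_le : κ' i ≤ κ := by simpa using (hκ'_lt i).le
  have : IsCardinalPresentable (A i) κ := isCardinalPresentable_of_le _ hκ'_le
  have := preservesColimitsOfShape_of_isCardinalPresentable (A i) κ κ.ord.ToType
  infer_instance

lemma isLocallyPresentable_functor (D : Type*) [Category* D] [EssentiallySmall.{w} D]
    (C : Type*) [Category* C] [HasPullbacks C] [IsLocallyPresentable.{w} C] :
    IsLocallyPresentable.{w} (D ⥤ C) := by
  let e : (SmallModel.{w} Dᵒᵖ)ᵒᵖ ≌ D :=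
    (equivSmallModel.{w} Dᵒᵖ).symm.op.trans (opOpEquivalence D)
  exact (e.congrLeft (E := C)).isLocallyPresentable

end SmallObject

/-! ### Reedy fibrations of simplicial objects -/

section ReedyFibrations

lemma ι_latchingMap {D : Type u} [Category.{w} D] [HasColimits D] (A : SimplexCategory ⥤ D) {n : ℕ}
    (σ : CostructuredArrow simplexFunctor.{w} (∂Δ[n] : SSet.{w})) :
    colimit.ι (CostructuredArrow.proj simplexFunctor.{w} (∂Δ[n] : SSet.{w}) ⋙ A) σ ≫
      latchingMap A n = A.map (boundaryHom σ) :=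
  colimit.ι_desc _ _

/-- The cotensor `Y ^ L`, defined as a limit, is the tensor `Yᵒᵖ ⊗ L` of the cosimplicial object
`Yᵒᵖ` of the opposite category. -/
def cotensorObjIso {D : Type u} [Category.{w} D] [HasLimits D]
    (Y : SimplexCategoryᵒᵖ ⥤ D) (L : SSet.{w}) :
    (tensorObj Y.rightOp L).unop ≅ cotensorObj Y L :=
  (isLimitConeOfCoconeRightOp ((CostructuredArrow.proj simplexFunctor.{w} L).op ⋙ Y)
    (colimit.isColimit
      (CostructuredArrow.proj simplexFunctor.{w} L ⋙ Y.rightOp))).conePointUniqueUpToIso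
    (limit.isLimit _)

lemma matchingMap_eq {D : Type u} [Category.{w} D] [HasLimits D]
    (Y : SimplexCategoryᵒᵖ ⥤ D) (n : ℕ) :
    matchingMap Y n =
      (latchingMap Y.rightOp n).unop ≫ (cotensorObjIso Y (∂Δ[n] : SSet.{w})).hom := by
  apply limit.hom_ext
  intro σ
  refine (limit.lift_π _ _).trans (Eq.trans ?_ (Category.assoc _ _ _).symm)
  refine Eq.trans ?_ (congrArg ((latchingMap Y.rightOp n).unop ≫ ·)
    (IsLimit.conePointUniqueUpToIso_hom_comp _ _ σ)).symm
  exact (congrArg Quiver.Hom.unop (ι_latchingMap Y.rightOp σ.unop)).symm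

lemma fibration_comp_iso_iff {D : Type*} [Category* D] [ModelCategory D] {X Y Z : D}
    (f : X ⟶ Y) (e : Y ≅ Z) : Fibration (f ≫ e.hom) ↔ Fibration f := by
  rw [fibration_iff, fibration_iff]
  exact MorphismProperty.cancel_right_of_respectsIso (fibrations D) f e.hom

lemma cofibration_comp_iso_iff {D : Type*} [Category* D] [ModelCategory D] {X Y Z : D}
    (f : X ⟶ Y) (e : Y ≅ Z) : Cofibration (f ≫ e.hom) ↔ Cofibration f := by
  rw [cofibration_iff, cofibration_iff]
  exact MorphismProperty.cancel_right_of_respectsIso (cofibrations D) f e.hom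

lemma cofibration_latchingMap_iff {D : Type u} [Category.{w} D] [HasColimits D]
    [ModelCategory D] (A : SimplexCategory ⥤ D) (n : ℕ) :
    Cofibration (latchingMap A n) ↔ Cofibration (tensorMap A (SSet.boundary.{w} n).ι) :=
  (iff_of_eq (congrArg (fun f ↦ Cofibration f) (latchingMap_eq A n))).trans
    (cofibration_comp_iso_iff _ _)

lemma fibration_matchingMap_iff {D : Type u} [Category.{w} D] [HasLimits D] [ModelCategory D]
    (Y : SimplexCategoryᵒᵖ ⥤ D) (n : ℕ) :
    Fibration (matchingMap Y n) ↔ Cofibration (tensorMap Y.rightOp (SSet.boundary.{w} n).ι) :=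
  (iff_of_eq (congrArg (fun f ↦ Fibration f) (matchingMap_eq Y n))).trans
    ((fibration_comp_iso_iff _ _).trans
      ((fibration_unop_iff _).trans (cofibration_latchingMap_iff Y.rightOp n)))

section

variable {C : Type u} [Category.{w} C] [HasLimits C] [HasColimits C]

/-- The morphisms `(∂Δ[n] ⊙ b) ∪ (Δ[n] ⊙ a) ⟶ Δ[n] ⊙ b` for `a ⟶ b` in `W` and `n ≥ 0`. -/
def reedyCells (W : MorphismProperty C) : MorphismProperty (SimplexCategoryᵒᵖ ⥤ C) :=
  MorphismProperty.ofHoms (fun x : W.toSet × ℕ ↦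
    copowerCorner (SSet.boundary.{w} x.2).ι x.1.1.hom)

instance (W : MorphismProperty C) [MorphismProperty.IsSmall.{w} W] :
    MorphismProperty.IsSmall.{w} (reedyCells W) := by
  dsimp only [reedyCells]
  infer_instance

lemma rlp_reedyCells_iff (W : MorphismProperty C) {Y Z : SimplexCategoryᵒᵖ ⥤ C} (p : Y ⟶ Z) :
    (reedyCells W).rlp p ↔ ∀ n : ℕ, W.rlp (relativeMatchingMap p (SSet.boundary.{w} n).ι) := by
  constructor
  · intro hp n a b j hj
    rw [← hasLiftingProperty_copowerCorner_iff]
    exact hp _ ⟨((⟨Arrow.mk j, hj⟩ : W.toSet), n)⟩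
  · rintro hp _ _ _ ⟨j, n⟩
    rw [hasLiftingProperty_copowerCorner_iff]
    exact hp n _ j.2

variable [ModelCategory C]

variable (C) in
/-- The Reedy fibrations of simplicial objects: the relative matching map in every degree is a
fibration. -/
def reedyFibrations : MorphismProperty (SimplexCategoryᵒᵖ ⥤ C) :=
  fun _ _ p ↦ ∀ n : ℕ, Fibration (relativeMatchingMap p (SSet.boundary.{w} n).ι)

lemma reedyFibrations_eq_rlp_reedyCells {J : MorphismProperty C} (hJ : J.rlp = fibrations C) :
    reedyFibrations C = (reedyCells J).rlp := by
  ext Y Z p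
  rw [rlp_reedyCells_iff, hJ]
  simp only [← fibration_iff]
  rfl

variable (C) in
lemma reedyFibrations_eq_rlp :
    reedyFibrations C = (reedyCells (trivialCofibrations C)).rlp :=
  reedyFibrations_eq_rlp_reedyCells (by rw [trivialCofibrations_rlp])

instance : (reedyFibrations C).IsStableUnderComposition := by
  rw [reedyFibrations_eq_rlp]
  infer_instance

instance : (reedyFibrations C).IsStableUnderBaseChange := by
  rw [reedyFibrations_eq_rlp]
  infer_instance

lemma trivialCofibration_app_of_llp {X Y : SimplexCategoryᵒᵖ ⥤ C} {c : X ⟶ Y}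
    (hc : (reedyFibrations C).llp c) (m : SimplexCategoryᵒᵖ) :
    Cofibration (c.app m) ∧ WeakEquivalence (c.app m) := by
  suffices trivialCofibrations C (c.app m) by
    rwa [mem_trivialCofibrations_iff] at this
  rw [← fibrations_llp]
  intro E B f hf
  have := (evaluationAdjunctionLeft C m).hasLiftingProperty_iff c f
  refine this.2 (hc _ ?_)
  rw [reedyFibrations_eq_rlp]
  rintro _ _ _ ⟨j, n⟩
  rw [← (evaluationAdjunctionLeft C m).hasLiftingProperty_iff]
  have : HasLiftingProperty j.1.hom f := by
    obtain ⟨_, _⟩ := (mem_trivialCofibrations_iff _).1 j.2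
    rw [← fibration_iff] at hf
    infer_instance
  exact hasLiftingProperty_copowerCorner_app _ _ _ _

lemma exists_reedy_factorization [IsLocallyPresentable.{w} C] {J : MorphismProperty C}
    [MorphismProperty.IsSmall.{w} J] (hJ : J.rlp = fibrations C)
    {X Y : SimplexCategoryᵒᵖ ⥤ C} (f : X ⟶ Y) :
    ∃ (Z : SimplexCategoryᵒᵖ ⥤ C) (c : X ⟶ Z) (p : Z ⟶ Y), c ≫ p = f ∧
      (reedyFibrations C).llp c ∧ reedyFibrations C p := by
  have := isLocallyPresentable_functor.{w} SimplexCategoryᵒᵖ C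
  have := hasSmallObjectArgument_of_isLocallyPresentable.{w} (reedyCells J)
  rw [reedyFibrations_eq_rlp_reedyCells hJ]
  let d := MorphismProperty.factorizationData (reedyCells J).rlp.llp (reedyCells J).rlp f
  exact ⟨d.Z, d.i, d.p, d.fac, d.hi, d.hp⟩

lemma reedyFibrations_iff_of_isTerminal {Y T : SimplexCategoryᵒᵖ ⥤ C} (hT : IsTerminal T)
    (p : Y ⟶ T) : reedyFibrations C p ↔ ∀ n : ℕ, Fibration (matchingMap Y n) := by
  refine forall_congr' (fun n ↦ ?_)
  have hT' (L : SSet.{w}) : IsTerminal ((cotensor.obj (op L)).obj T) := by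
    have := ((copowerAdj C).adj L).rightAdjoint_preservesLimits
    exact hT.isTerminalObj (cotensor.obj (op L))
  let i := (SSet.boundary.{w} n).ι
  have := isIso_of_isTerminal (hT' Δ[n]) (hT' (SSet.boundary.{w} n : SSet.{w}))
    ((cotensor.map i.op).app T)
  let sq : cotensor.PullbackObjObj i p :=
    { pt := (cotensor.obj (op (SSet.boundary.{w} n : SSet.{w}))).obj Y
      fst := 𝟙 _
      snd := (hT' _).from _
      isPullback := IsPullback.of_horiz_isIso ⟨(hT' _).hom_ext _ _⟩
      π := (cotensor.map i.op).app Y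
      π_fst := Category.comp_id _
      π_snd := (hT' _).hom_ext _ _ }
  rw [fibration_matchingMap_iff, ← fibration_unop_iff, fibration_iff, fibration_iff,
    ← trivialCofibrations_rlp]
  refine forall_congr' fun a ↦ forall_congr' fun b ↦ forall_congr' fun j ↦
    forall_congr' fun _ ↦ ?_
  rw [← hasLiftingProperty_copowerCorner_iff]
  exact (copowerAdj C).hasLiftingProperty_iff _ sq

end

end ReedyFibrations

/-! ### Existence of cosimplicial resolutions -/

section CosimplicialResolutions

variable {C : Type u} [Category.{w} C]

lemma matchingMap_op [HasColimits C] (Q : SimplexCategory ⥤ C) (n : ℕ) :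
    matchingMap Q.op n = (latchingMap Q n).op ≫
      (limitOpIsoOpColimit (CostructuredArrow.proj simplexFunctor.{w}
        (∂Δ[n] : SSet.{w}) ⋙ Q)).inv := by
  apply limit.hom_ext
  intro σ
  refine (limit.lift_π _ _).trans (Eq.trans ?_ (Category.assoc _ _ _).symm)
  refine Eq.trans ?_ (congrArg ((latchingMap Q n).op ≫ ·)
    (limitOpIsoOpColimit_inv_comp_π _ σ)).symm
  exact (congrArg Quiver.Hom.op (ι_latchingMap Q σ.unop)).symm

lemma trivialCofibration_copowerCorner_app [HasColimits C] [ModelCategory C] {K L : SSet.{w}}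
    (i : K ⟶ L) [Mono i] {a b : C} (j : a ⟶ b) [Cofibration j] [WeakEquivalence j]
    (m : SimplexCategoryᵒᵖ) :
    Cofibration ((copowerCorner i j).app m) ∧ WeakEquivalence ((copowerCorner i j).app m) := by
  rw [← mem_trivialCofibrations_iff, ← fibrations_llp]
  intro E B f hf
  rw [← fibration_iff] at hf
  exact hasLiftingProperty_copowerCorner_app _ _ _ _

/-- The images of the morphisms in `W` under the left adjoints of all evaluation functors, so
that the right lifting property against them is the levelwise one against `W`. -/
def evaluationCells [HasColimits C] (W : MorphismProperty C) :
    MorphismProperty (SimplexCategory ⥤ C) :=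
  MorphismProperty.ofHoms (fun x : W.toSet × SimplexCategory ↦
    (evaluationLeftAdjoint C x.2).map x.1.1.hom)

instance [HasColimits C] (W : MorphismProperty C) [MorphismProperty.IsSmall.{w} W] :
    MorphismProperty.IsSmall.{w} (evaluationCells W) := by
  dsimp only [evaluationCells]
  infer_instance

lemma rlp_evaluationCells_iff [HasColimits C] (W : MorphismProperty C)
    {E B : SimplexCategory ⥤ C} (p : E ⟶ B) :
    (evaluationCells W).rlp p ↔ ∀ m, W.rlp (p.app m) := by
  constructor
  · intro hp m a b i hi
    exact ((evaluationAdjunctionRight C m).hasLiftingProperty_iff i p).1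
      (hp _ ⟨((⟨Arrow.mk i, hi⟩ : W.toSet), m)⟩)
  · rintro hp _ _ _ ⟨i, m⟩
    exact ((evaluationAdjunctionRight C m).hasLiftingProperty_iff i.1.hom p).2 (hp m _ i.2)

variable [HasLimits C] [HasColimits C] [ModelCategory C]

lemma cofibration_latchingMap_of_exists_lift {Q : SimplexCategory ⥤ C}
    (hQ : ∀ {E B : SimplexCategory ⥤ C} (p : E ⟶ B)
      (_ : ∀ m, Fibration (p.app m) ∧ WeakEquivalence (p.app m)) (v : Q ⟶ B),
      ∃ l : Q ⟶ E, l ≫ p = v) (n : ℕ) : Cofibration (latchingMap Q n) := by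
  have hQ_op : reedyFibrations Cᵒᵖ (terminal.from Q.op) := by
    rw [reedyFibrations_eq_rlp]
    rintro X Y _ ⟨j, n⟩
    constructor
    intro f g sq
    obtain ⟨_, _⟩ := (mem_trivialCofibrations_iff _).1 j.2
    let e := copowerCorner (SSet.boundary.{w} n).ι j.1.hom
    obtain ⟨l, hl⟩ := hQ (NatTrans.unop e) (fun m ↦ by
      obtain ⟨_, _⟩ := trivialCofibration_copowerCorner_app (SSet.boundary.{w} n).ι j.1.hom (op m)
      exact ⟨inferInstanceAs (Fibration (e.app (op m)).unop),
        inferInstanceAs (WeakEquivalence (e.app (op m)).unop)⟩) (NatTrans.unop f)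
    exact ⟨⟨⟨NatTrans.op l, congrArg NatTrans.op hl, terminalIsTerminal.hom_ext _ _⟩⟩⟩
  have h_matching := (reedyFibrations_iff_of_isTerminal terminalIsTerminal _).1 hQ_op n
  rw [matchingMap_op] at h_matching
  exact (fibration_op_iff (latchingMap Q n)).1
    ((fibration_comp_iso_iff _ (limitOpIsoOpColimit _).symm).1 h_matching)

lemma nonempty_cosimplicialResolution [IsLocallyPresentable.{w} C] {I : MorphismProperty C}
    [MorphismProperty.IsSmall.{w} I] (hI : I.rlp = trivialFibrations C) (A : C) :
    Nonempty (CosimplicialResolution (inferInstanceAs (ModelCategory C)) A) := by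
  have := isLocallyPresentable_functor.{w} SimplexCategory C
  have := hasSmallObjectArgument_of_isLocallyPresentable.{w} (evaluationCells I)
  have rlp_iff {E B : SimplexCategory ⥤ C} (p : E ⟶ B) :
      (evaluationCells I).rlp p ↔ ∀ m, Fibration (p.app m) ∧ WeakEquivalence (p.app m) := by
    simp only [rlp_evaluationCells_iff, hI, mem_trivialFibrations_iff]
  let d := MorphismProperty.factorizationData (evaluationCells I).rlp.llp (evaluationCells I).rlp
    (initial.to ((Functor.const SimplexCategory).obj A))
  refine ⟨{ obj := d.Z, π := d.p, weakEquivalence := fun m ↦ ((rlp_iff _).1 d.hp m).2,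
            reedyCofibrant := cofibration_latchingMap_of_exists_lift fun p hp v ↦ ?_ }⟩
  have : HasLiftingProperty d.i p := d.hi p ((rlp_iff p).2 hp)
  have sq : CommSq (initial.to _) d.i p v := ⟨initialIsInitial.hom_ext _ _⟩
  exact ⟨sq.lift, sq.fac_right⟩

end CosimplicialResolutions

/-! ### Singular complexes of Reedy cofibrant homotopically constant cosimplicial objects -/

section SingularComplexes

open SSet.modelCategoryQuillen

lemma fibration_of_hasLiftingProperty_horn {E B : SSet.{w}} {q : E ⟶ B}
    (hq : ∀ (n : ℕ) (i : Fin (n + 2)), HasLiftingProperty (SSet.horn.{w} (n + 1) i).ι q) :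
    Fibration q := by
  rw [SSet.modelCategoryQuillen.fibration_iff]
  intro X Y i hi
  simp only [J, MorphismProperty.iSup_iff] at hi
  obtain ⟨n, ⟨i⟩⟩ := hi
  exact hq n i

lemma rlp_I_iff {E B : SSet.{w}} (q : E ⟶ B) :
    I.rlp q ↔ ∀ n : ℕ, HasLiftingProperty (SSet.boundary.{w} n).ι q := by
  constructor
  · intro hq n
    exact hq _ (boundary_ι_mem_I n)
  · rintro hq _ _ _ ⟨n⟩
    exact hq n

lemma rlp_singular_map_iff {D : Type u} [Category.{w} D] [HasColimits D] (A : SimplexCategory ⥤ D)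
    {X Y : D} (f : X ⟶ Y) :
    I.rlp ((singular A).map f) ↔
      ∀ n : ℕ, HasLiftingProperty (tensorMap A (SSet.boundary.{w} n).ι) f := by
  rw [rlp_I_iff]
  exact forall_congr' fun n ↦
    ((tensorAdj A).hasLiftingProperty_iff (SSet.boundary.{w} n).ι f).symm

variable {D : Type u} [Category.{w} D] [HasColimits D] [ModelCategory D]
  {A : SimplexCategory ⥤ D}

lemma weakEquivalence_tensorMap_iff {m n : SimplexCategory} (f : m ⟶ n) :
    WeakEquivalence (tensorMap A (SSet.stdSimplex.{w}.map f)) ↔ WeakEquivalence (A.map f) := by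
  have naturality := tensorStdSimplexIso_inv_tensorMap.{w} A f
  constructor
  · intro
    have : WeakEquivalence (A.map f ≫ (tensorStdSimplexIso A n).inv) := by
      rw [← naturality]
      infer_instance
    exact weakEquivalence_of_postcomp (A.map f) (tensorStdSimplexIso A n).inv
  · intro
    have : WeakEquivalence ((tensorStdSimplexIso A m).inv ≫
        tensorMap A (SSet.stdSimplex.{w}.map f)) := by
      rw [naturality]
      infer_instance
    exact weakEquivalence_of_precomp (tensorStdSimplexIso A m).inv _

lemma isReedyCofibrantConstant_tensorFunctor (hA : ∀ n : ℕ, Cofibration (latchingMap A n))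
    (hA' : ∀ {m n : SimplexCategory} (f : m ⟶ n), WeakEquivalence (A.map f)) :
    IsReedyCofibrantConstant (tensorFunctor A) where
  isLeftAdjoint := inferInstance
  cofibration n := (cofibration_latchingMap_iff A n).1 (hA n)
  weakEquivalence f := (weakEquivalence_tensorMap_iff f).2 (hA' f)

variable (hA : IsReedyCofibrantConstant (tensorFunctor A)) {X Y : D} (f : X ⟶ Y)

include hA

lemma fibration_singular_map [Fibration f] : Fibration ((singular A).map f) := by
  apply fibration_of_hasLiftingProperty_horn
  intro n i
  rw [← (tensorAdj A).hasLiftingProperty_iff]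
  have := cofibration_map_horn (tensorFunctor A) hA.cofibration (n + 1) i
  have := hA.weakEquivalence_horn n i
  infer_instance

variable (X) in
lemma kanComplex_singular_obj [IsFibrant X] : SSet.KanComplex ((singular A).obj X) := by
  have := (tensorAdj A).rightAdjoint_preservesLimits
  have hT : IsTerminal ((singular A).obj (⊤_ D)) := terminalIsTerminal.isTerminalObj (singular A)
  have := fibration_singular_map hA (terminal.from X)
  exact (isFibrant_iff_of_isTerminal ((singular A).map (terminal.from X)) hT).2 this

lemma rlp_singular_map [Fibration f] [WeakEquivalence f] : I.rlp ((singular A).map f) := by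
  rw [rlp_singular_map_iff A]
  intro n
  have := hA.cofibration n
  exact inferInstanceAs (HasLiftingProperty ((tensorFunctor A).map (SSet.boundary.{w} n).ι) f)

lemma isWeakHomotopyEquivalence_singular_map [IsFibrant X] [IsFibrant Y] [WeakEquivalence f] :
    IsWeakHomotopyEquivalence ((singular A).map f) := by
  -- Ken Brown: `f` is a section of a trivial fibration followed by a trivial fibration.
  let h : FibrantBrownFactorization f := Classical.arbitrary _
  have hr : weakHomotopyEquivalences ((singular A).map h.r) :=
    isWeakHomotopyEquivalence_of_rlp (rlp_singular_map hA h.r)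
  have hp : weakHomotopyEquivalences ((singular A).map h.p) :=
    isWeakHomotopyEquivalence_of_rlp (rlp_singular_map hA h.p)
  have hi : weakHomotopyEquivalences ((singular A).map h.i) := by
    refine weakHomotopyEquivalences.of_postcomp _ _ hr ?_
    rw [← (singular A).map_comp, h.i_r, (singular A).map_id]
    exact weakHomotopyEquivalences.id_mem _
  rw [← h.fac, (singular A).map_comp]
  exact weakHomotopyEquivalences.comp_mem _ _ hi hp

lemma isWeakHomotopyEquivalence_singular_map_iff [IsFibrant X] [IsFibrant Y] [Fibration f] :
    IsWeakHomotopyEquivalence ((singular A).map f) ↔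
      ∀ n : ℕ, HasLiftingProperty (tensorMap A (SSet.boundary.{w} n).ι) f := by
  have := fibration_singular_map hA f
  have := kanComplex_singular_obj hA X
  have := kanComplex_singular_obj hA Y
  rw [isWeakHomotopyEquivalence_iff_rlp, rlp_singular_map_iff]

end SingularComplexes

/-! ### Homotopy function complexes -/

section FunctionComplexes

open SSet.modelCategoryQuillen

variable {C : Type u} [Category.{w} C]

lemma hasLiftingProperty_iff_of_isInitial {X₀ X E B : C} (hX : IsInitial X₀) (i : X₀ ⟶ X)
    (q : E ⟶ B) : HasLiftingProperty i q ↔ ∀ b : X ⟶ B, ∃ e : X ⟶ E, e ≫ q = b := by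
  constructor
  · intro _ b
    have sq : CommSq (hX.to E) i q b := ⟨hX.hom_ext _ _⟩
    exact ⟨sq.lift, sq.fac_right⟩
  · intro h
    constructor
    intro f g sq
    obtain ⟨e, he⟩ := h g
    exact ⟨⟨⟨e, hX.hom_ext _ _, he⟩⟩⟩

section

variable [ModelCategory C]

lemma exists_lift_iff_of_trivialCofibration {X W E B : C} (j : X ⟶ W) [Cofibration j]
    [WeakEquivalence j] (q : E ⟶ B) [Fibration q] [IsFibrant B] :
    (∀ b : X ⟶ B, ∃ e : X ⟶ E, e ≫ q = b) ↔ ∀ b : W ⟶ B, ∃ e : W ⟶ E, e ≫ q = b := by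
  constructor
  · intro h b
    obtain ⟨e, he⟩ := h (j ≫ b)
    have sq : CommSq e j q b := ⟨he⟩
    exact ⟨sq.lift, sq.fac_right⟩
  · intro h b
    have sq : CommSq b j (terminal.from B) (terminal.from W) := ⟨Subsingleton.elim _ _⟩
    obtain ⟨e, he⟩ := h sq.lift
    exact ⟨j ≫ e, by rw [Category.assoc, he, sq.fac_left]⟩

lemma exists_lift_iff_of_weakEquivalence {X X' X₀ E B : C} [IsCofibrant X] [IsCofibrant X']
    (f : X ⟶ X₀) (f' : X' ⟶ X₀) [WeakEquivalence f] [WeakEquivalence f'] (q : E ⟶ B)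
    [Fibration q] [IsFibrant B] :
    (∀ b : X ⟶ B, ∃ e : X ⟶ E, e ≫ q = b) ↔ ∀ b : X' ⟶ B, ∃ e : X' ⟶ E, e ≫ q = b := by
  let d := MorphismProperty.factorizationData (cofibrations C) (trivialFibrations C)
    (coprod.desc f f')
  have inl_fac : (coprod.inl ≫ d.i) ≫ d.p = f := by rw [Category.assoc, d.fac, coprod.inl_desc]
  have inr_fac : (coprod.inr ≫ d.i) ≫ d.p = f' := by rw [Category.assoc, d.fac, coprod.inr_desc]
  have := weakEquivalence_of_postcomp_of_fac inl_fac
  have := weakEquivalence_of_postcomp_of_fac inr_fac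
  rw [exists_lift_iff_of_trivialCofibration (coprod.inl ≫ d.i) q,
    exists_lift_iff_of_trivialCofibration (coprod.inr ≫ d.i) q]

end

variable [HasLimits C]

/-- A Reedy fibrant simplicial object whose structure maps are weak equivalences. -/
structure IsReedyFibrantConstant [ModelCategory C] (Y : SimplexCategoryᵒᵖ ⥤ C) : Prop where
  fibration (n : ℕ) : Fibration (matchingMap Y n)
  weakEquivalence {m n : SimplexCategoryᵒᵖ} (f : m ⟶ n) : WeakEquivalence (Y.map f)

lemma IsReedyFibrantConstant.tensorFunctor [ModelCategory C] {Y : SimplexCategoryᵒᵖ ⥤ C}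
    (hY : IsReedyFibrantConstant Y) : IsReedyCofibrantConstant (tensorFunctor Y.rightOp) :=
  isReedyCofibrantConstant_tensorFunctor
    (fun n ↦ (cofibration_latchingMap_iff _ _).2 ((fibration_matchingMap_iff Y n).1
      (hY.fibration n)))
    (fun f ↦ by
      have := hY.weakEquivalence f.op
      exact inferInstanceAs (WeakEquivalence (Y.map f.op).op))

section

variable {Y Z : SimplexCategoryᵒᵖ ⥤ C} (p : Y ⟶ Z)

lemma tensorStdSimplexIso_inv_tensorTransApp (m : SimplexCategory) :
    (tensorStdSimplexIso.{w} Z.rightOp m).inv ≫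
      tensorTransApp (NatTrans.rightOp p) (SSet.stdSimplex.obj m) =
    (p.app (op m)).op ≫ (tensorStdSimplexIso.{w} Y.rightOp m).inv :=
  tensorι_tensorTransApp (NatTrans.rightOp p) _

/-- The relative matching map in degree zero. -/
def relativeMatchingMapZeroIso :
    Arrow.mk (relativeMatchingMap p (SSet.boundary.{w} 0).ι) ≅ Arrow.mk (p.app (op ⦋0⦌)) := by
  let τ := tensorTrans (NatTrans.rightOp p)
  have h : IsInitial (∂Δ[0] : SSet.{w}) := by
    rw [SSet.boundary_zero]
    exact SSet.Subcomplex.isInitialBot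
  have : IsIso (τ.app (∂Δ[0] : SSet.{w})) :=
    isIso_of_isInitial (h.isInitialObj (tensorFunctor Z.rightOp))
      (h.isInitialObj (tensorFunctor Y.rightOp)) _
  refine Arrow.isoMk (tensorStdSimplexIso Y.rightOp ⦋0⦌).symm.unop
    (asIso (pushout.inl ((tensorFunctor Z.rightOp).map (SSet.boundary.{w} 0).ι)
      (τ.app (∂Δ[0] : SSet.{w}))).unop ≪≫ (tensorStdSimplexIso Z.rightOp ⦋0⦌).symm.unop) ?_
  refine congrArg Quiver.Hom.unop ((tensorStdSimplexIso_inv_tensorTransApp p ⦋0⦌).symm.trans ?_)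
  refine Eq.trans ?_ (Category.assoc _ _ _).symm
  exact congrArg ((tensorStdSimplexIso.{w} Z.rightOp ⦋0⦌).inv ≫ ·)
    (inl_relativeLatchingMap τ (SSet.boundary.{w} 0).ι).symm

lemma rlp_homComplexMap_iff [HasColimits C] (X : C) :
    I.rlp (homComplexMap X p) ↔ ∀ n : ℕ, ∀ b, ∃ e : X ⟶ _,
      e ≫ relativeMatchingMap p (SSet.boundary.{w} n).ι = b := by
  rw [rlp_I_iff]
  refine forall_congr' fun n ↦ ?_
  rw [hasLiftingProperty_homComplexMap_iff, hasLiftingProperty_iff_of_isInitial initialIsInitial]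

end

section

variable [ModelCategory C] {Y Z : SimplexCategoryᵒᵖ ⥤ C} {p : Y ⟶ Z}

lemma fibration_app_zero (hp : reedyFibrations C p) : Fibration (p.app (op ⦋0⦌)) := by
  have := hp 0
  rw [HomotopicalAlgebra.fibration_iff] at this ⊢
  exact ((fibrations C).arrow_mk_iso_iff (relativeMatchingMapZeroIso p)).1 this

lemma cofibration_relativeLatchingMap_of_reedyFibrations (hp : reedyFibrations C p) (n : ℕ) :
    Cofibration (relativeLatchingMap (tensorTrans (NatTrans.rightOp p))
      (SSet.boundary.{w} n).ι) :=
  (fibration_unop_iff _).1 (hp n)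

lemma weakEquivalence_tensorTransApp_stdSimplex {m : SimplexCategory}
    (hp : WeakEquivalence (p.app (op m))) :
    WeakEquivalence (tensorTransApp (NatTrans.rightOp p) (SSet.stdSimplex.{w}.obj m)) := by
  have : WeakEquivalence ((tensorStdSimplexIso.{w} Z.rightOp m).inv ≫
      tensorTransApp (NatTrans.rightOp p) (SSet.stdSimplex.obj m)) := by
    rw [tensorStdSimplexIso_inv_tensorTransApp]
    infer_instance
  exact weakEquivalence_of_precomp (tensorStdSimplexIso.{w} Z.rightOp m).inv _

variable [HasColimits C] (hp : reedyFibrations C p) (hY : IsReedyFibrantConstant Y)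
  (hZ : IsReedyFibrantConstant Z) (X : C) [IsCofibrant X]

include hp hY hZ

lemma fibration_homComplexMap : Fibration (homComplexMap X p) := by
  apply fibration_of_hasLiftingProperty_horn
  intro n i
  rw [hasLiftingProperty_homComplexMap_iff]
  have := cofibration_relativeLatchingMap_horn _
    (cofibration_relativeLatchingMap_of_reedyFibrations hp) (n + 1) i
  have := weakEquivalence_relativeLatchingMap_horn (tensorTrans (NatTrans.rightOp p))
    hZ.tensorFunctor hY.tensorFunctor n i
  dsimp only [relativeMatchingMap]
  infer_instance

lemma rlp_homComplexMap (hp' : ∀ m, WeakEquivalence (p.app m)) :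
    I.rlp (homComplexMap X p) := by
  rw [rlp_I_iff]
  intro n
  rw [hasLiftingProperty_homComplexMap_iff]
  have := cofibration_relativeLatchingMap_of_reedyFibrations hp n
  have := weakEquivalence_relativeLatchingMap_boundary _ hZ.tensorFunctor hY.tensorFunctor
    (cofibration_relativeLatchingMap_of_reedyFibrations hp)
    (fun n ↦ weakEquivalence_tensorTransApp_stdSimplex (hp' (op ⦋n⦌))) n
  dsimp only [relativeMatchingMap]
  infer_instance

end

section

variable [HasColimits C] [ModelCategory C]

lemma isReedyFibrantConstant_of_isTerminal {T : SimplexCategoryᵒᵖ ⥤ C} (hT : IsTerminal T) :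
    IsReedyFibrantConstant T where
  fibration := (reedyFibrations_iff_of_isTerminal hT (𝟙 T)).1 (by
    rw [reedyFibrations_eq_rlp]
    exact MorphismProperty.id_mem _ _)
  weakEquivalence {m n} f := by
    have := isIso_of_isTerminal (hT.isTerminalObj ((evaluation _ _).obj m))
      (hT.isTerminalObj ((evaluation _ _).obj n)) (T.map f)
    infer_instance

lemma kanComplex_homComplex {Y : SimplexCategoryᵒᵖ ⥤ C} (hY : IsReedyFibrantConstant Y) (X : C)
    [IsCofibrant X] : SSet.KanComplex (homComplex X Y) := by
  have : PreservesLimitsOfSize.{0, 0} ((Functor.whiskeringRight SimplexCategoryᵒᵖ C _).obj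
      (coyoneda.obj (op X))) :=
    ((sigmaConstAdj X).whiskerRight SimplexCategoryᵒᵖ).rightAdjoint_preservesLimits
  have hT : IsTerminal (homComplex X (⊤_ (SimplexCategoryᵒᵖ ⥤ C))) :=
    terminalIsTerminal.isTerminalObj ((Functor.whiskeringRight _ _ _).obj (coyoneda.obj (op X)))
  have hp : reedyFibrations C (terminal.from Y) :=
    (reedyFibrations_iff_of_isTerminal terminalIsTerminal _).2 hY.fibration
  exact (isFibrant_iff_of_isTerminal (homComplexMap X (terminal.from Y)) hT).2
    (fibration_homComplexMap hp hY (isReedyFibrantConstant_of_isTerminal terminalIsTerminal) X)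

variable (hC : ∀ X : C, IsFibrant X) {Y Z : SimplexCategoryᵒᵖ ⥤ C} {p : Y ⟶ Z}
  (hp : reedyFibrations C p) (hY : IsReedyFibrantConstant Y) (hZ : IsReedyFibrantConstant Z)
  {X X₀ : C} [IsCofibrant X] (f : X ⟶ X₀) [WeakEquivalence f]
  {A : SimplexCategory ⥤ C} (hA : IsReedyCofibrantConstant (tensorFunctor A))
  (g : A.obj ⦋0⦌ ⟶ X₀) [WeakEquivalence g]

include hC hp hY hZ f hA g

lemma exists_lift_relativeMatchingMap_iff (n : ℕ) :
    (∀ b, ∃ e : X ⟶ _, e ≫ relativeMatchingMap p (SSet.boundary.{w} n).ι = b) ↔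
      HasLiftingProperty (tensorMap A (SSet.boundary.{w} n).ι) (p.app (op ⦋0⦌)) := by
  have := hp n
  have := hC (pushout ((tensorFunctor Z.rightOp).map (SSet.boundary.{w} n).ι)
    ((tensorTrans (NatTrans.rightOp p)).app _)).unop
  have : IsCofibrant (tensorObj A Δ[0]) := hA.isCofibrant 0
  have isInitial_boundary : IsInitial (∂Δ[0] : SSet.{w}) := by
    rw [SSet.boundary_zero]
    exact SSet.Subcomplex.isInitialBot
  rw [exists_lift_iff_of_weakEquivalence f ((tensorStdSimplexIso A ⦋0⦌).hom ≫ g),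
    ← hasLiftingProperty_iff_of_isInitial (isInitial_boundary.isInitialObj (tensorFunctor A))
      (tensorMap A (SSet.boundary.{w} 0).ι),
    ← HasLiftingProperty.iff_of_arrow_iso_right _ (relativeMatchingMapZeroIso p)]
  exact (hasLiftingProperty_latching_iff (tensorTrans (NatTrans.rightOp p)) hA
    hZ.tensorFunctor hY.tensorFunctor
    (cofibration_relativeLatchingMap_of_reedyFibrations hp) hC n).symm

lemma isWeakHomotopyEquivalence_homComplexMap_iff_of_reedyFibrations :
    IsWeakHomotopyEquivalence (homComplexMap X p) ↔
      IsWeakHomotopyEquivalence ((singular A).map (p.app (op ⦋0⦌))) := by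
  have := fibration_homComplexMap hp hY hZ X
  have := kanComplex_homComplex hY X
  have := kanComplex_homComplex hZ X
  have := fibration_app_zero hp
  have := hC (Y.obj (op ⦋0⦌))
  have := hC (Z.obj (op ⦋0⦌))
  rw [isWeakHomotopyEquivalence_iff_rlp, rlp_homComplexMap_iff,
    isWeakHomotopyEquivalence_singular_map_iff hA]
  exact forall_congr' (exists_lift_relativeMatchingMap_iff hC hp hY hZ f hA g)

end

end FunctionComplexes

/-! ### Characterization of the colocal equivalences -/

section ColocalEquivalences

lemma homComplexMap_comp {C : Type u} [Category.{w} C] (X : C)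
    {Y Y' Y'' : SimplexCategoryᵒᵖ ⥤ C} (f : Y ⟶ Y') (g : Y' ⟶ Y'') :
    homComplexMap X (f ≫ g) = homComplexMap X f ≫ homComplexMap X g :=
  Functor.whiskerRight_comp _ _ _

lemma homComplexMap_id {C : Type u} [Category.{w} C] (X : C) (Y : SimplexCategoryᵒᵖ ⥤ C) :
    homComplexMap X (𝟙 Y) = 𝟙 (homComplex X Y) :=
  Functor.whiskerRight_id' _

variable {C : Type u} [Category.{w} C] [HasLimits C]

section

variable [M : ModelCategory C]

lemma SimplicialResolution.isReedyFibrantConstant {Y : C} (r : SimplicialResolution M Y) :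
    IsReedyFibrantConstant r.obj where
  fibration := r.reedyFibrant
  weakEquivalence {m n} f := by
    have := r.weakEquivalence
    have h := r.ι.naturality f
    have : WeakEquivalence (r.ι.app m ≫ r.obj.map f) := by
      rw [← h]
      exact inferInstanceAs (WeakEquivalence (𝟙 Y ≫ r.ι.app n))
    exact weakEquivalence_of_precomp (r.ι.app m) _

lemma CosimplicialResolution.isReedyCofibrantConstant {C : Type u} [Category.{w} C]
    [HasColimits C] [M : ModelCategory C] {A : C} (r : CosimplicialResolution M A) :
    IsReedyCofibrantConstant (tensorFunctor r.obj) :=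
  isReedyCofibrantConstant_tensorFunctor r.reedyCofibrant (fun {m n} f ↦ by
    have := r.weakEquivalence
    have h := r.π.naturality f
    have : WeakEquivalence (r.obj.map f ≫ r.π.app n) := by
      rw [h]
      have : WeakEquivalence (((Functor.const SimplexCategory).obj A).map f) :=
        inferInstanceAs (WeakEquivalence (𝟙 A))
      infer_instance
    exact weakEquivalence_of_postcomp _ (r.π.app n))

/-- The cofibrant approximation `A^• ⊗ Δ[0]` of `A` underlying a cosimplicial resolution `A^•`. It
is used instead of the isomorphic object `A^0` because `IsReedyCofibrantConstant` speaks about the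
objects `A^• ⊗ Δ[n]`. -/
def CosimplicialResolution.cofibrantApproximation {C : Type u} [Category.{w} C]
    [HasColimits C] [M : ModelCategory C] {A : C} (r : CosimplicialResolution M A) :
    CofibrantApproximation M A where
  obj := tensorObj r.obj Δ[0]
  π := (tensorStdSimplexIso r.obj ⦋0⦌).hom ≫ r.π.app ⦋0⦌
  cofibrant := r.isReedyCofibrantConstant.isCofibrant 0
  weakEquivalence := by
    have := r.weakEquivalence ⦋0⦌
    infer_instance

end

variable [HasColimits C] [M : ModelCategory C]

lemma IsReedyFibrantConstant.reedyFibrations_from {U T : SimplexCategoryᵒᵖ ⥤ C}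
    (hU : IsReedyFibrantConstant U) (hT : IsTerminal T) : reedyFibrations C (hT.from U) :=
  (reedyFibrations_iff_of_isTerminal hT _).2 hU.fibration

lemma IsReedyFibrantConstant.of_reedyFibrations {U W : SimplexCategoryᵒᵖ ⥤ C}
    (hU : IsReedyFibrantConstant U) {p : W ⟶ U} (hp : reedyFibrations C p)
    (hp' : ∀ m, WeakEquivalence (p.app m)) : IsReedyFibrantConstant W where
  fibration := (reedyFibrations_iff_of_isTerminal terminalIsTerminal _).1
    ((reedyFibrations C).comp_mem _ _ hp (hU.reedyFibrations_from terminalIsTerminal))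
  weakEquivalence {m n} f := by
    have := hU.weakEquivalence f
    have : WeakEquivalence (W.map f ≫ p.app n) := by
      rw [p.naturality]
      infer_instance
    exact weakEquivalence_of_postcomp _ (p.app n)

variable [IsLocallyPresentable.{w} C]
  {J : MorphismProperty C} [MorphismProperty.IsSmall.{w} J] (hJ : J.rlp = fibrations C)

include hJ

lemma nonempty_simplicialResolutionHom {X Y : C} (f : X ⟶ Y) :
    Nonempty (SimplicialResolutionHom M f) := by
  obtain ⟨U, c, p, -, hc, hp⟩ := exists_reedy_factorization hJ
    (terminal.from ((Functor.const SimplexCategoryᵒᵖ).obj X))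
  obtain ⟨V, d, q, -, hd, hq⟩ := exists_reedy_factorization hJ
    (terminal.from ((Functor.const SimplexCategoryᵒᵖ).obj Y))
  have := hc q hq
  have sq : CommSq ((Functor.const SimplexCategoryᵒᵖ).map f ≫ d) c q (terminal.from _) :=
    ⟨Subsingleton.elim _ _⟩
  exact ⟨{
    source :=
      { obj := U
        ι := c
        weakEquivalence m := (trivialCofibration_app_of_llp hc m).2
        reedyFibrant := (reedyFibrations_iff_of_isTerminal terminalIsTerminal _).1 hp }
    target :=
      { obj := V
        ι := d
        weakEquivalence m := (trivialCofibration_app_of_llp hd m).2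
        reedyFibrant := (reedyFibrations_iff_of_isTerminal terminalIsTerminal _).1 hq }
    hom := sq.lift
    comm := sq.fac_left }⟩

lemma exists_mappingPath_factorization {U V : SimplexCategoryᵒᵖ ⥤ C}
    (hU : IsReedyFibrantConstant U) (hV : IsReedyFibrantConstant V) (r : U ⟶ V) :
    ∃ (W : SimplexCategoryᵒᵖ ⥤ C) (c : U ⟶ W) (p : W ⟶ U) (q : W ⟶ V),
      c ≫ p = 𝟙 U ∧ c ≫ q = r ∧ reedyFibrations C p ∧ (∀ m, WeakEquivalence (p.app m)) ∧
        reedyFibrations C q := by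
  obtain ⟨W, c, pq, fac, hc, hpq⟩ := exists_reedy_factorization hJ (prod.lift (𝟙 U) r)
  have isPullback_prod :
      IsPullback (prod.fst : U ⨯ V ⟶ U) prod.snd (terminal.from U) (terminal.from V) :=
    IsPullback.of_is_product (prodIsProd U V) terminalIsTerminal
  have fac_fst : c ≫ pq ≫ prod.fst = 𝟙 U := by rw [← Category.assoc, fac, prod.lift_fst]
  have fac_snd : c ≫ pq ≫ prod.snd = r := by rw [← Category.assoc, fac, prod.lift_snd]
  refine ⟨W, c, pq ≫ prod.fst, pq ≫ prod.snd, fac_fst, fac_snd, ?_, fun m ↦ ?_, ?_⟩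
  · exact (reedyFibrations C).comp_mem _ _ hpq ((reedyFibrations C).of_isPullback
      isPullback_prod.flip (hV.reedyFibrations_from terminalIsTerminal))
  · have := (trivialCofibration_app_of_llp hc m).2
    have fac_app := NatTrans.congr_app fac_fst m
    rw [NatTrans.comp_app, NatTrans.id_app] at fac_app
    exact weakEquivalence_of_precomp_of_fac fac_app
  · exact (reedyFibrations C).comp_mem _ _ hpq ((reedyFibrations C).of_isPullback
      isPullback_prod (hU.reedyFibrations_from terminalIsTerminal))

variable (hC : ∀ X : C, IsFibrant X)

include hC

lemma isWeakHomotopyEquivalence_homComplexMap_iff {U V : SimplexCategoryᵒᵖ ⥤ C}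
    (hU : IsReedyFibrantConstant U) (hV : IsReedyFibrantConstant V) (r : U ⟶ V)
    {X X₀ : C} [IsCofibrant X] (f : X ⟶ X₀) [WeakEquivalence f]
    {A : SimplexCategory ⥤ C} (hA : IsReedyCofibrantConstant (tensorFunctor A))
    (g : A.obj ⦋0⦌ ⟶ X₀) [WeakEquivalence g] :
    IsWeakHomotopyEquivalence (homComplexMap X r) ↔
      IsWeakHomotopyEquivalence ((singular A).map (r.app (op ⦋0⦌))) := by
  obtain ⟨W, c, p, q, hcp, rfl, hp, hp', hq⟩ := exists_mappingPath_factorization hJ hU hV r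
  have hW := hU.of_reedyFibrations hp hp'
  have homComplexMap_p : weakHomotopyEquivalences (homComplexMap X p) :=
    isWeakHomotopyEquivalence_of_rlp (rlp_homComplexMap hp hW hU X hp')
  have homComplexMap_c : weakHomotopyEquivalences (homComplexMap X c) := by
    refine MorphismProperty.of_postcomp weakHomotopyEquivalences _ _ homComplexMap_p ?_
    rw [← homComplexMap_comp, hcp, homComplexMap_id]
    exact weakHomotopyEquivalences.id_mem _
  have singular_map_c : weakHomotopyEquivalences ((singular A).map (c.app (op ⦋0⦌))) := by
    have := hC (U.obj (op ⦋0⦌))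
    have := hC (W.obj (op ⦋0⦌))
    have := hp' (op ⦋0⦌)
    have hcp_app := NatTrans.congr_app hcp (op ⦋0⦌)
    rw [NatTrans.comp_app, NatTrans.id_app] at hcp_app
    have := weakEquivalence_of_postcomp_of_fac hcp_app
    exact isWeakHomotopyEquivalence_singular_map hA _
  rw [homComplexMap_comp, NatTrans.comp_app, (singular A).map_comp]
  exact (weakHomotopyEquivalences.precomp_iff _ _ homComplexMap_c).trans
    ((isWeakHomotopyEquivalence_homComplexMap_iff_of_reedyFibrations hC hq hW hV f hA g).trans
      (weakHomotopyEquivalences.precomp_iff _ _ singular_map_c).symm)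

lemma SimplicialResolutionHom.isWeakHomotopyEquivalence_iff {Y Z : C} {h : Y ⟶ Z}
    (r : SimplicialResolutionHom M h) {A : C} (X : CofibrantApproximation M A)
    (s : CosimplicialResolution M A) :
    IsWeakHomotopyEquivalence (homComplexMap X.obj r.hom) ↔
      IsWeakHomotopyEquivalence ((singular s.obj).map h) := by
  have := X.cofibrant
  have := X.weakEquivalence
  have hs := s.isReedyCofibrantConstant
  have := s.weakEquivalence ⦋0⦌
  rw [isWeakHomotopyEquivalence_homComplexMap_iff hJ hC
    r.source.isReedyFibrantConstant r.target.isReedyFibrantConstant r.hom X.π hs (s.π.app ⦋0⦌)]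
  have comm_zero : r.source.ι.app (op ⦋0⦌) ≫ r.hom.app (op ⦋0⦌) = h ≫ r.target.ι.app (op ⦋0⦌) :=
    NatTrans.congr_app r.comm (op ⦋0⦌)
  have := r.source.weakEquivalence (op ⦋0⦌)
  have := r.target.weakEquivalence (op ⦋0⦌)
  have source_ι : weakHomotopyEquivalences ((singular s.obj).map (r.source.ι.app (op ⦋0⦌))) := by
    have := hC (((Functor.const SimplexCategoryᵒᵖ).obj Y).obj (op ⦋0⦌))
    have := hC (r.source.obj.obj (op ⦋0⦌))
    exact isWeakHomotopyEquivalence_singular_map hs _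
  have target_ι : weakHomotopyEquivalences ((singular s.obj).map (r.target.ι.app (op ⦋0⦌))) := by
    have := hC (((Functor.const SimplexCategoryᵒᵖ).obj Z).obj (op ⦋0⦌))
    have := hC (r.target.obj.obj (op ⦋0⦌))
    exact isWeakHomotopyEquivalence_singular_map hs _
  refine (weakHomotopyEquivalences.precomp_iff _ _ source_ι).symm.trans ?_
  refine Iff.trans ?_ (weakHomotopyEquivalences.postcomp_iff _ _ target_ι)
  rw [← (singular s.obj).map_comp, ← (singular s.obj).map_comp, comm_zero]

lemma colocalEquivalences_iff (K : ObjectProperty C)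
    (res : ∀ A : C, K A → CosimplicialResolution M A) {Y Z : C} (h : Y ⟶ Z) :
    colocalEquivalences M K h ↔ ∀ (A : C) (hA : K A),
      IsWeakHomotopyEquivalence ((singular (res A hA).obj).map h) := by
  refine forall₂_congr fun A hA ↦ ⟨?_, fun hh ↦ ?_⟩
  · rintro ⟨X, r, hr⟩
    exact (r.isWeakHomotopyEquivalence_iff hJ hC X (res A hA)).1 hr
  · obtain ⟨r⟩ := nonempty_simplicialResolutionHom hJ h
    let X := (res A hA).cofibrantApproximation
    exact ⟨X, r, (r.isWeakHomotopyEquivalence_iff hJ hC X (res A hA)).2 hh⟩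

end ColocalEquivalences

/-! ### Existence of the right Bousfield localization -/

section Recognition

variable {D : Type*} [Category* D]

lemma rlp_sup (W W' : MorphismProperty D) : (W ⊔ W').rlp = W.rlp ⊓ W'.rlp := by
  ext X Y p
  exact ⟨fun h ↦ ⟨fun _ _ i hi ↦ h i (Or.inl hi), fun _ _ i hi ↦ h i (Or.inr hi)⟩,
    fun h _ _ i hi ↦ hi.elim (h.1 i) (h.2 i)⟩

lemma isSmall_sup (W W' : MorphismProperty D) [MorphismProperty.IsSmall.{w} W]
    [MorphismProperty.IsSmall.{w} W'] : MorphismProperty.IsSmall.{w} (W ⊔ W') := by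
  have (b : Bool) : MorphismProperty.IsSmall.{w} (cond b W W') := by
    cases b <;> dsimp only [cond] <;> infer_instance
  rw [sup_eq_iSup]
  infer_instance

lemma isSmall_of_hasSmallObjectArgument (W : MorphismProperty D)
    [MorphismProperty.HasSmallObjectArgument.{w} W] : MorphismProperty.IsSmall.{w} W := by
  obtain ⟨κ, _, _, h⟩ := MorphismProperty.HasSmallObjectArgument.exists_cardinal.{w} (I := W)
  exact h.isSmall

lemma hasTwoOutOfThreeProperty_iInf {ι : Type*} (W : ι → MorphismProperty D)
    [∀ i, (W i).HasTwoOutOfThreeProperty] : (⨅ i, W i).HasTwoOutOfThreeProperty where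
  comp_mem f g hf hg := by
    simp only [MorphismProperty.iInf_iff] at hf hg ⊢
    exact fun i ↦ (W i).comp_mem f g (hf i) (hg i)
  of_postcomp f g hg hfg := by
    simp only [MorphismProperty.iInf_iff] at hg hfg ⊢
    exact fun i ↦ (W i).of_postcomp f g (hg i) (hfg i)
  of_precomp f g hf hfg := by
    simp only [MorphismProperty.iInf_iff] at hf hfg ⊢
    exact fun i ↦ (W i).of_precomp f g (hf i) (hfg i)

lemma isWeakFactorizationSystem_of_hasSmallObjectArgument (W : MorphismProperty D)
    [MorphismProperty.HasSmallObjectArgument.{w} W] :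
    MorphismProperty.IsWeakFactorizationSystem W.rlp.llp W.rlp where
  rlp := MorphismProperty.rlp_llp_rlp W
  llp := rfl
  hasFactorization := inferInstanceAs (MorphismProperty.HasFactorization W.rlp.llp W.rlp)

lemma rlp_llp_eq_inf (W I J : MorphismProperty D)
    [W.HasTwoOutOfThreeProperty] [MorphismProperty.HasFactorization J.rlp.llp J.rlp]
    (hI : I.rlp = J.rlp ⊓ W) (hJ : J.rlp.llp ≤ W) : J.rlp.llp = I.rlp.llp ⊓ W := by
  apply le_antisymm
  · exact le_inf (MorphismProperty.antitone_llp (hI.le.trans inf_le_left)) hJ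
  · rintro X Y f ⟨hf, hfW⟩
    let d := MorphismProperty.factorizationData J.rlp.llp J.rlp f
    have hpW : W d.p := W.of_precomp d.i d.p (hJ _ d.hi) (by rwa [d.fac])
    have hpI : I.rlp d.p := by
      rw [hI]
      exact ⟨d.hp, hpW⟩
    have := hf _ hpI
    exact MorphismProperty.of_retract (RetractArrow.ofLeftLiftingProperty d.fac) d.hi

lemma exists_modelCategory [HasFiniteLimits D] [HasFiniteColimits D]
    (W I J : MorphismProperty D) [W.HasTwoOutOfThreeProperty]
    [MorphismProperty.HasSmallObjectArgument.{w} I]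
    [MorphismProperty.HasSmallObjectArgument.{w} J] (hI : I.rlp = J.rlp ⊓ W)
    (hJ : J.rlp.llp ≤ W) :
    ∃ R : ModelCategory D, R.categoryWithWeakEquivalences.weakEquivalences = W ∧
      R.categoryWithFibrations.fibrations = J.rlp := by
  let _ : CategoryWithFibrations D := ⟨J.rlp⟩
  let _ : CategoryWithCofibrations D := ⟨I.rlp.llp⟩
  let _ : CategoryWithWeakEquivalences D := ⟨W⟩
  have : (weakEquivalences D).HasTwoOutOfThreeProperty := ‹W.HasTwoOutOfThreeProperty›
  have trivialFibrations_eq : trivialFibrations D = I.rlp := hI.symm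
  have trivialCofibrations_eq : trivialCofibrations D = J.rlp.llp :=
    (rlp_llp_eq_inf W I J hI hJ).symm
  have : MorphismProperty.IsWeakFactorizationSystem (cofibrations D) (trivialFibrations D) := by
    rw [trivialFibrations_eq]
    exact isWeakFactorizationSystem_of_hasSmallObjectArgument.{w} I
  have : MorphismProperty.IsWeakFactorizationSystem (trivialCofibrations D) (fibrations D) := by
    rw [trivialCofibrations_eq]
    exact isWeakFactorizationSystem_of_hasSmallObjectArgument.{w} J
  exact ⟨ModelCategory.mk' D, rfl, rfl⟩

end Recognition

section Localization

variable {C : Type u} [Category.{w} C]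

lemma IsRightBousfieldLocalization.allObjectsFibrant [HasLimits C] {M R : ModelCategory C}
    {K : ObjectProperty C} (hR : IsRightBousfieldLocalization M K R)
    (hC : AllObjectsFibrant M) : AllObjectsFibrant R := fun X ↦ ⟨by
  have mem_fibrations : M.categoryWithFibrations.fibrations (terminal.from X) := (hC X).mem
  rwa [← hR.fibrations_eq] at mem_fibrations⟩

variable [HasColimits C] [IsLocallyPresentable.{w} C]

lemma hasSmallObjectArgument_Lambda_sup {M : ModelCategory C} {K : ObjectProperty C}
    [ObjectProperty.Small.{w} K] (res : ∀ A : C, K A → CosimplicialResolution M A)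
    (J : MorphismProperty C) [MorphismProperty.IsSmall.{w} J] :
    MorphismProperty.HasSmallObjectArgument.{w} (Lambda K res ⊔ J) := by
  have : MorphismProperty.IsSmall.{w} (Lambda K res) := by
    dsimp only [Lambda]
    infer_instance
  have := isSmall_sup.{w} (Lambda K res) J
  exact hasSmallObjectArgument_of_isLocallyPresentable.{w} _

variable [HasLimits C] {M : ModelCategory C}

section

variable {J : MorphismProperty C} [MorphismProperty.IsSmall.{w} J] (hJ : J.rlp = fibrations C)
  (hC : AllObjectsFibrant M) {K : ObjectProperty C}
  (res : ∀ A : C, K A → CosimplicialResolution M A)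

include hJ hC

lemma rlp_Lambda_sup : (Lambda K res ⊔ J).rlp = J.rlp ⊓ colocalEquivalences M K := by
  rw [rlp_sup, inf_comm]
  ext X Y f
  refine and_congr_right fun hf ↦ ?_
  rw [hJ, ← fibration_iff] at hf
  have := hC X
  have := hC Y
  have singular_map_iff (A : C) (hA : K A) := isWeakHomotopyEquivalence_singular_map_iff
    (res A hA).isReedyCofibrantConstant f
  simp only [colocalEquivalences_iff hJ hC K res, singular_map_iff]
  constructor
  · intro h A hA n
    exact h _ ⟨((⟨A, hA⟩ : Subtype K), n)⟩
  · rintro h _ _ _ ⟨⟨⟨A, hA⟩, n⟩⟩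
    exact h A hA n

include res

lemma hasTwoOutOfThreeProperty_colocalEquivalences :
    (colocalEquivalences M K).HasTwoOutOfThreeProperty := by
  have : colocalEquivalences M K = ⨅ A : Subtype K,
      weakHomotopyEquivalences.inverseImage (singular (res A.1 A.2).obj) := by
    ext X Y f
    simp only [colocalEquivalences_iff hJ hC K res, MorphismProperty.iInf_iff, Subtype.forall]
    rfl
  rw [this]
  exact hasTwoOutOfThreeProperty_iInf _

lemma weakEquivalences_le_colocalEquivalences :
    weakEquivalences C ≤ colocalEquivalences M K := by
  intro X Y f hf
  rw [← weakEquivalence_iff] at hf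
  rw [colocalEquivalences_iff hJ hC K res]
  intro A hA
  have := hC X
  have := hC Y
  exact isWeakHomotopyEquivalence_singular_map (res A hA).isReedyCofibrantConstant f

end

variable {I J : MorphismProperty C} (h : IsCofibrantlyGeneratedBy M I J)

include h

lemma IsCofibrantlyGeneratedBy.nonempty_cosimplicialResolution (A : C) :
    Nonempty (CosimplicialResolution M A) := by
  have := h.smallObjectArgument_I
  have := isSmall_of_hasSmallObjectArgument.{w} I
  exact RightBousfield.nonempty_cosimplicialResolution h.rlp_I A

variable (hC : AllObjectsFibrant M) {K : ObjectProperty C} [ObjectProperty.Small.{w} K]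

include hC

lemma exists_isRightBousfieldLocalization :
    ∃ R : ModelCategory C, IsRightBousfieldLocalization M K R := by
  have := h.smallObjectArgument_J
  have := isSmall_of_hasSmallObjectArgument.{w} J
  let res (A : C) (_ : K A) : CosimplicialResolution M A :=
    (h.nonempty_cosimplicialResolution A).some
  have := hasTwoOutOfThreeProperty_colocalEquivalences h.rlp_J hC res
  have := hasSmallObjectArgument_Lambda_sup res J
  have trivialCofibrations_le : J.rlp.llp ≤ colocalEquivalences M K := by
    rw [h.rlp_J, fibrations_llp]
    exact inf_le_right.trans (weakEquivalences_le_colocalEquivalences h.rlp_J hC res)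
  obtain ⟨R, hW, hF⟩ := exists_modelCategory.{w} (colocalEquivalences M K) (Lambda K res ⊔ J) J
    (rlp_Lambda_sup h.rlp_J hC res) trivialCofibrations_le
  exact ⟨R, hW, hF.trans h.rlp_J⟩

variable {R : ModelCategory C} (hR : IsRightBousfieldLocalization M K R)

include hR

lemma IsRightBousfieldLocalization.isCofibrantlyGeneratedBy_Lambda_sup
    (res : ∀ A : C, K A → CosimplicialResolution M A) :
    IsCofibrantlyGeneratedBy R (Lambda K res ⊔ J) J := by
  have := h.smallObjectArgument_J
  have := isSmall_of_hasSmallObjectArgument.{w} J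
  have rlp_J : J.rlp = R.categoryWithFibrations.fibrations := h.rlp_J.trans hR.fibrations_eq.symm
  refine ⟨hasSmallObjectArgument_Lambda_sup res J, inferInstance, ?_, rlp_J⟩
  rw [rlp_Lambda_sup h.rlp_J hC res, rlp_J, ← hR.weakEquivalences_eq]
  rfl

end Localization

end

end RightBousfield

open RightBousfield in
theorem mainTheorem6 {C : Type u} [Category.{w} C] [HasLimits C] [HasColimits C]
    (M : ModelCategory C) (hM : RightBousfield.IsCombinatorial M)
    (hfib : RightBousfield.AllObjectsFibrant M)
    (K : ObjectProperty C) (hK : ObjectProperty.Small.{w} K) :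
    ∃ R : ModelCategory C,
      RightBousfield.IsRightBousfieldLocalization M K R ∧
      RightBousfield.IsCombinatorial R ∧
      RightBousfield.AllObjectsFibrant R ∧
      (∀ A : C, K A → Nonempty (RightBousfield.CosimplicialResolution M A)) ∧
      ∀ (res : ∀ A : C, K A → RightBousfield.CosimplicialResolution M A)
        (I J : MorphismProperty C), RightBousfield.IsCofibrantlyGeneratedBy M I J →
          RightBousfield.IsCofibrantlyGeneratedBy R (RightBousfield.Lambda K res ⊔ J) J := by
  have := hM.isLocallyPresentable
  obtain ⟨I₀, J₀, h₀⟩ := hM.exists_generators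
  obtain ⟨R, hR⟩ := exists_isRightBousfieldLocalization h₀ hfib (K := K)
  have exists_resolution (A : C) : Nonempty (CosimplicialResolution M A) :=
    h₀.nonempty_cosimplicialResolution A
  have generators (res : ∀ A : C, K A → CosimplicialResolution M A) (I J : MorphismProperty C)
      (h : IsCofibrantlyGeneratedBy M I J) : IsCofibrantlyGeneratedBy R (Lambda K res ⊔ J) J :=
    hR.isCofibrantlyGeneratedBy_Lambda_sup h hfib res
  let res₀ (A : C) (_ : K A) : CosimplicialResolution M A := (exists_resolution A).some
  exact ⟨R, hR, ⟨inferInstance, _, _, generators res₀ I₀ J₀ h₀⟩, hR.allObjectsFibrant hfib,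
    fun A _ ↦ exists_resolution A, generators⟩
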